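/- **Proposition 4.2.** Let $G=(G_n)_{n\ge 0}$ be one of the four series of free quantum groups $O^+,S^+,H^+,B^+$: $C(G_n)$ is the universal unital $C^*$-algebra generated by the entries $u_{ij}$ of an $n\times n$ matrix $u$ that is, respectively, - ($O^+$) orthogonal: the $u_{ij}$ are self-adjoint and $uu^t=u^tu=1$; - ($S^+$) magic: orthogonal, and the $u_{ij}$ are projections; - ($H^+$) cubic: orthogonal, and $xy=0$ for any two distinct entries $x,y$ in the same row or in the same column of $u$; - ($B^+$) bistochastic: orthogonal, and each row and each column of $u$ has sum $1$. The comultiplication is $\Delta:C(G_n)\to C(G_n)\otimes C(G_n)$, $\Delta(u_{ij})=\sum_s u_{is}\otimes u_{sj}$, where $\otimes$ is the minimal tensor product. For $0\le k\le n$ let $v$ be the matrix of generators of $C(G_k)$, and let $\pi:C(G_n)\to C(G_k)$ be the morphism sending $u$ to $\mathrm{diag}(v,1_{n-k})$. Put $$C(G_n/G_k)=\{f\in C(G_n)\mid (\pi\otimes \mathrm{id})\Delta f=1\otimes f\},$$ and let $C_\times(G_n/G_k)$ be the unital $C^*$-subalgebra of $C(G_n)$ generated by the $u_{ij}$ with $i>k$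 and $1\le j\le n$; it is contained in $C(G_n/G_k)$. The inclusion $C_\times(G_n/G_k)\subset C(G_n/G_k)$ is an isomorphism in each of the following cases: 1. $n=1$, or $k=0$, or $k=n$, for each of the four series; 2. $G=B^+$ and $k=1$; 3. $G=S^+$ and $k=1$, or $G=S^+$ and $(k,n)=(2,3)$. -/

import Mathlib

open scoped TensorProduct Matrix

set_option linter.unusedSectionVars false

noncomputable section

/-- A C*-seminorm on a complex unital *-algebra. -/
structure CStarSeminorm (𝒜 : Type) [Ring 𝒜] [StarRing 𝒜] [Algebra ℂ 𝒜] where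
  toFun : 𝒜 → ℝ
  add_le : ∀ a b, toFun (a + b) ≤ toFun a + toFun b
  smul_eq : ∀ (c : ℂ) a, toFun (c • a) = ‖c‖ * toFun a
  mul_le : ∀ a b, toFun (a * b) ≤ toFun a * toFun b
  star_eq : ∀ a, toFun (star a) = toFun a
  star_mul_self : ∀ a, toFun (star a * a) = toFun a * toFun a

namespace CStarSeminorm

section Completion

variable {𝒜 : Type} [Ring 𝒜] [StarRing 𝒜] [Algebra ℂ 𝒜] [StarModule ℂ 𝒜]

/-- The algebra `𝒜`, to be equipped with the seminorm `p`. -/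
def Pre (_p : CStarSeminorm 𝒜) : Type := 𝒜

variable (p : CStarSeminorm 𝒜)

instance : Ring p.Pre := inferInstanceAs (Ring 𝒜)
instance : StarRing p.Pre := inferInstanceAs (StarRing 𝒜)
instance : Algebra ℂ p.Pre := inferInstanceAs (Algebra ℂ 𝒜)
instance : StarModule ℂ p.Pre := inferInstanceAs (StarModule ℂ 𝒜)

/-- The identity map `𝒜 → p.Pre`. -/
def toPre : 𝒜 →⋆ₐ[ℂ] p.Pre := StarAlgHom.id ℂ 𝒜

lemma zero_eq : p.toFun 0 = 0 := by
  have := p.smul_eq 0 0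
  simpa using this

lemma neg_eq (a : 𝒜) : p.toFun (-a) = p.toFun a := by
  have := p.smul_eq (-1) a
  simpa using this

instance : SeminormedAddCommGroup p.Pre :=
  AddGroupSeminorm.toSeminormedAddCommGroup
    { toFun := p.toFun
      map_zero' := p.zero_eq
      add_le' := p.add_le
      neg' := p.neg_eq : AddGroupSeminorm p.Pre }

lemma norm_toPre (a : 𝒜) : ‖p.toPre a‖ = p.toFun a := rfl

instance : SeminormedRing p.Pre where
  __ := (inferInstance : SeminormedAddCommGroup p.Pre)
  __ := (inferInstance : Ring p.Pre)
  norm_mul_le a b := p.mul_le a b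

instance : NormedAlgebra ℂ p.Pre where
  norm_smul_le c a := (p.smul_eq c a).le

lemma norm_star_pre (a : p.Pre) : ‖star a‖ = ‖a‖ := p.star_eq a

lemma norm_star_mul_self_pre (a : p.Pre) : ‖star a * a‖ = ‖a‖ * ‖a‖ := p.star_mul_self a

lemma isometry_star_pre : Isometry (star : p.Pre → p.Pre) :=
  AddMonoidHomClass.isometry_of_norm (starAddEquiv (R := p.Pre)) p.norm_star_pre

/-- The Hausdorff completion of `𝒜` with respect to the C*-seminorm `p`. -/
def CStar : Type := UniformSpace.Completion p.Pre

open UniformSpace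

instance : NormedRing p.CStar := inferInstanceAs (NormedRing (Completion p.Pre))
instance : CompleteSpace p.CStar := inferInstanceAs (CompleteSpace (Completion p.Pre))
instance : Algebra ℂ p.CStar := inferInstanceAs (Algebra ℂ (Completion p.Pre))
instance : ContinuousConstSMul ℂ p.CStar :=
  inferInstanceAs (ContinuousConstSMul ℂ (Completion p.Pre))

/-- The canonical map of `p.Pre` to the completion. -/
def coe (a : p.Pre) : p.CStar := (a : Completion p.Pre)

lemma continuous_coe : Continuous p.coe := Completion.continuous_coe _
lemma denseRange_coe : DenseRange p.coe := Completion.denseRange_coe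
lemma coe_add (a b : p.Pre) : p.coe (a + b) = p.coe a + p.coe b := Completion.coe_add a b
lemma coe_mul (a b : p.Pre) : p.coe (a * b) = p.coe a * p.coe b := Completion.coe_mul a b
lemma coe_smul (c : ℂ) (a : p.Pre) : p.coe (c • a) = c • p.coe a := Completion.coe_smul c a
lemma coe_one : p.coe 1 = 1 := Completion.coe_one _
lemma coe_zero : p.coe 0 = 0 := Completion.coe_zero
lemma norm_coe (a : p.Pre) : ‖p.coe a‖ = ‖a‖ := Completion.norm_coe a

instance : Star p.CStar where
  star := Completion.map (star : p.Pre → p.Pre)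

lemma continuous_star_cstar : Continuous (star : p.CStar → p.CStar) := Completion.continuous_map

lemma star_coe (a : p.Pre) : star (p.coe a) = p.coe (star a) :=
  Completion.map_coe p.isometry_star_pre.uniformContinuous a

instance : StarRing p.CStar where
  star_involutive x := by
    refine p.denseRange_coe.induction_on x ?_ ?_
    · exact isClosed_eq (p.continuous_star_cstar.comp p.continuous_star_cstar) continuous_id
    · intro a; rw [star_coe, star_coe, star_star]
  star_mul x y := by
    refine p.denseRange_coe.induction_on₂ ?_ ?_ x y
    · exact isClosed_eq (p.continuous_star_cstar.comp continuous_mul)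
        ((p.continuous_star_cstar.comp continuous_snd).mul
          (p.continuous_star_cstar.comp continuous_fst))
    · intro a b; rw [← coe_mul, star_coe, star_coe, star_coe, star_mul, coe_mul]
  star_add x y := by
    refine p.denseRange_coe.induction_on₂ ?_ ?_ x y
    · exact isClosed_eq (p.continuous_star_cstar.comp continuous_add)
        ((p.continuous_star_cstar.comp continuous_fst).add
          (p.continuous_star_cstar.comp continuous_snd))
    · intro a b; rw [← coe_add, star_coe, star_coe, star_coe, star_add, coe_add]

instance : CStarAlgebra p.CStar where
  norm_smul_le c x := norm_smul_le (β := Completion p.Pre) c x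
  star_smul c x := by
    refine p.denseRange_coe.induction_on x ?_ ?_
    · exact isClosed_eq (p.continuous_star_cstar.comp (continuous_const_smul c))
        ((continuous_const_smul _).comp p.continuous_star_cstar)
    · intro a; rw [← coe_smul, star_coe, star_coe, star_smul, coe_smul]
  norm_mul_self_le x := by
    refine p.denseRange_coe.induction_on x ?_ ?_
    · exact isClosed_le (continuous_norm.mul continuous_norm)
        ((p.continuous_star_cstar.mul continuous_id).norm)
    · intro a
      rw [star_coe, ← coe_mul, norm_coe, norm_coe, norm_star_mul_self_pre]

/-- The canonical *-homomorphism of `𝒜` to its completion. -/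
def ι : 𝒜 →⋆ₐ[ℂ] p.CStar where
  toFun a := p.coe (p.toPre a)
  map_one' := p.coe_one
  map_mul' a b := p.coe_mul a b
  map_zero' := p.coe_zero
  map_add' a b := p.coe_add a b
  commutes' c := by
    rw [Algebra.algebraMap_eq_smul_one, map_smul, map_one, coe_smul, coe_one,
      Algebra.algebraMap_eq_smul_one]
  map_star' a := (p.star_coe a).symm

lemma norm_ι (a : 𝒜) : ‖p.ι a‖ = p.toFun a := p.norm_coe a

lemma denseRange_ι : DenseRange p.ι := p.denseRange_coe

section lift

variable {B : Type} [CStarAlgebra B] (φ : 𝒜 →⋆ₐ[ℂ] B)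

/-- The underlying map of `lift`. -/
def liftFun : p.CStar → B :=
  Completion.extension (fun a : p.Pre => φ a)

lemma uniformContinuous_pre (h : ∀ a, ‖φ a‖ ≤ p.toFun a) : UniformContinuous (fun a : p.Pre => φ a) := by
  have : LipschitzWith 1 (fun a : p.Pre => φ a) := by
    refine LipschitzWith.of_dist_le_mul fun a b => ?_
    have e : φ a - φ b = φ (a - b : p.Pre) := (map_sub φ a b).symm
    rw [dist_eq_norm, dist_eq_norm, e]
    rw [NNReal.coe_one, one_mul]
    exact h (a - b : p.Pre)
  exact this.uniformContinuous

lemma continuous_liftFun : Continuous (p.liftFun φ) := Completion.continuous_extension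

lemma liftFun_ι (h : ∀ a, ‖φ a‖ ≤ p.toFun a) (a : 𝒜) : p.liftFun φ (p.ι a) = φ a :=
  Completion.extension_coe (p.uniformContinuous_pre φ h) a

/-- A *-homomorphism that is bounded by `p` extends to the completion. -/
def lift (h : ∀ a, ‖φ a‖ ≤ p.toFun a) : p.CStar →⋆ₐ[ℂ] B where
  toFun := p.liftFun φ
  map_one' := by rw [← map_one p.ι, p.liftFun_ι φ h, map_one]
  map_mul' x y := by
    refine p.denseRange_ι.induction_on₂ ?_ ?_ x y
    · exact isClosed_eq ((p.continuous_liftFun φ).comp continuous_mul)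
        (((p.continuous_liftFun φ).comp continuous_fst).mul
          ((p.continuous_liftFun φ).comp continuous_snd))
    · intro a b
      rw [← map_mul, p.liftFun_ι φ h, p.liftFun_ι φ h, p.liftFun_ι φ h, map_mul]
  map_zero' := by rw [← map_zero p.ι, p.liftFun_ι φ h, map_zero]
  map_add' x y := by
    refine p.denseRange_ι.induction_on₂ ?_ ?_ x y
    · exact isClosed_eq ((p.continuous_liftFun φ).comp continuous_add)
        (((p.continuous_liftFun φ).comp continuous_fst).add
          ((p.continuous_liftFun φ).comp continuous_snd))
    · intro a b
      rw [← map_add, p.liftFun_ι φ h, p.liftFun_ι φ h, p.liftFun_ι φ h, map_add]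
  commutes' c := by
    rw [← AlgHomClass.commutes p.ι c, p.liftFun_ι φ h, AlgHomClass.commutes φ c]
  map_star' x := by
    refine p.denseRange_ι.induction_on x ?_ ?_
    · exact isClosed_eq ((p.continuous_liftFun φ).comp p.continuous_star_cstar)
        (continuous_star.comp (p.continuous_liftFun φ))
    · intro a
      rw [← StarHomClass.map_star p.ι a, p.liftFun_ι φ h, p.liftFun_ι φ h, StarHomClass.map_star]

lemma lift_ι (h : ∀ a, ‖φ a‖ ≤ p.toFun a) (a : 𝒜) : p.lift φ h (p.ι a) = φ a := p.liftFun_ι φ h a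

end lift

end Completion

end CStarSeminorm

/-- A unital *-representation of a *-algebra by bounded operators on a Hilbert space. -/
structure OpRep (𝒜 : Type) [Ring 𝒜] [StarRing 𝒜] [Algebra ℂ 𝒜] where
  H : Type
  [normed : NormedAddCommGroup H]
  [inner : InnerProductSpace ℂ H]
  [complete : CompleteSpace H]
  ρ : 𝒜 →⋆ₐ[ℂ] (H →L[ℂ] H)

attribute [instance] OpRep.normed OpRep.inner OpRep.complete

namespace OpRep

variable {𝒜 ℬ : Type} [Ring 𝒜] [StarRing 𝒜] [Algebra ℂ 𝒜] [Ring ℬ] [StarRing ℬ] [Algebra ℂ ℬ]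

/-- Pull back a representation along a *-homomorphism. -/
def comp (r : OpRep ℬ) (φ : 𝒜 →⋆ₐ[ℂ] ℬ) : OpRep 𝒜 where
  H := r.H
  ρ := r.ρ.comp φ

/-- The C*-seminorm `a ↦ sup ‖ρ a‖`, the supremum over the representations `ρ` in a family `S` that
is pointwise bounded. -/
def supSeminorm (S : Set (OpRep 𝒜)) (hS : ∀ a, BddAbove (Set.range fun r : S => ‖r.1.ρ a‖)) :
    CStarSeminorm 𝒜 where
  toFun a := ⨆ r : S, ‖r.1.ρ a‖
  add_le a b := by
    refine Real.iSup_le (fun r => ?_) (add_nonneg (Real.iSup_nonneg fun _ => norm_nonneg _)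
      (Real.iSup_nonneg fun _ => norm_nonneg _))
    rw [map_add]
    exact (norm_add_le _ _).trans (add_le_add (le_ciSup (hS a) r) (le_ciSup (hS b) r))
  smul_eq c a := by
    simp_rw [map_smul, norm_smul]
    exact (Real.mul_iSup_of_nonneg (norm_nonneg c) _).symm
  mul_le a b := by
    refine Real.iSup_le (fun r => ?_) (mul_nonneg (Real.iSup_nonneg fun _ => norm_nonneg _)
      (Real.iSup_nonneg fun _ => norm_nonneg _))
    rw [map_mul]
    exact (norm_mul_le _ _).trans (mul_le_mul (le_ciSup (hS a) r) (le_ciSup (hS b) r)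
      (norm_nonneg _) (Real.iSup_nonneg fun _ => norm_nonneg _))
  star_eq a := by simp_rw [map_star, norm_star]
  star_mul_self a := by
    have h0 : 0 ≤ ⨆ r : S, ‖r.1.ρ a‖ := Real.iSup_nonneg fun _ => norm_nonneg _
    have e : ∀ r : S, ‖r.1.ρ (star a * a)‖ = ‖r.1.ρ a‖ * ‖r.1.ρ a‖ := fun r => by
      rw [map_mul, map_star, CStarRing.norm_star_mul_self]
    apply le_antisymm
    · refine Real.iSup_le (fun r => ?_) (mul_nonneg h0 h0)
      rw [e r]
      exact mul_le_mul (le_ciSup (hS a) r) (le_ciSup (hS a) r) (norm_nonneg _) h0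
    · rw [← sq, ← Real.le_sqrt h0 (Real.iSup_nonneg fun _ => norm_nonneg _)]
      refine Real.iSup_le (fun r => Real.le_sqrt_of_sq_le ?_) (Real.sqrt_nonneg _)
      rw [sq, ← e r]
      exact le_ciSup (hS (star a * a)) r

lemma supSeminorm_le {S : Set (OpRep 𝒜)}
    {hS : ∀ a, BddAbove (Set.range fun r : S => ‖r.1.ρ a‖)} {a : 𝒜} {C : ℝ} (hC : 0 ≤ C)
    (h : ∀ r ∈ S, ‖r.ρ a‖ ≤ C) : (supSeminorm S hS).toFun a ≤ C :=
  Real.iSup_le (fun r => h r.1 r.2) hC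

lemma le_supSeminorm {S : Set (OpRep 𝒜)}
    {hS : ∀ a, BddAbove (Set.range fun r : S => ‖r.1.ρ a‖)} {r : OpRep 𝒜} (hr : r ∈ S) (a : 𝒜) :
    ‖r.ρ a‖ ≤ (supSeminorm S hS).toFun a :=
  le_ciSup (hS a) (⟨r, hr⟩ : S)

end OpRep

/-- The norm of the C*-algebra `B` is determined by its representations on Hilbert spaces. -/
def NormedByReps (B : Type) [CStarAlgebra B] : Prop :=
  ∀ (b : B) (C : ℝ), 0 ≤ C → (∀ r : OpRep B, ‖r.ρ b‖ ≤ C) → ‖b‖ ≤ C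

lemma normedByReps_supSeminorm {𝒜 : Type} [Ring 𝒜] [StarRing 𝒜] [Algebra ℂ 𝒜] [StarModule ℂ 𝒜]
    (S : Set (OpRep 𝒜)) (hS : ∀ a, BddAbove (Set.range fun r : S => ‖r.1.ρ a‖)) :
    NormedByReps (OpRep.supSeminorm S hS).CStar := by
  intro b C hC h
  refine le_of_forall_pos_le_add fun ε hε => ?_
  obtain ⟨a, ha⟩ := (OpRep.supSeminorm S hS).denseRange_ι.exists_dist_lt b (half_pos hε)
  rw [dist_eq_norm] at ha
  have h1 : ‖(OpRep.supSeminorm S hS).ι a‖ ≤ C + ε / 2 := by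
    rw [CStarSeminorm.norm_ι]
    refine OpRep.supSeminorm_le (by positivity) fun r hr => ?_
    let R : OpRep (OpRep.supSeminorm S hS).CStar :=
      { H := r.H, ρ := (OpRep.supSeminorm S hS).lift r.ρ (OpRep.le_supSeminorm hr) }
    have e : r.ρ a = R.ρ b - R.ρ (b - (OpRep.supSeminorm S hS).ι a) := by
      rw [map_sub, sub_sub_cancel]
      exact ((OpRep.supSeminorm S hS).lift_ι r.ρ (OpRep.le_supSeminorm hr) a).symm
    have h2 : ‖R.ρ (b - (OpRep.supSeminorm S hS).ι a)‖ ≤ ‖b - (OpRep.supSeminorm S hS).ι a‖ := NonUnitalStarAlgHom.norm_apply_le R.ρ _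
    rw [e]
    exact (norm_sub_le _ _).trans (add_le_add (h R) (h2.trans ha.le))
  calc ‖b‖ = ‖(b - (OpRep.supSeminorm S hS).ι a) + (OpRep.supSeminorm S hS).ι a‖ := by rw [sub_add_cancel]
    _ ≤ ‖b - (OpRep.supSeminorm S hS).ι a‖ + ‖(OpRep.supSeminorm S hS).ι a‖ := norm_add_le _ _
    _ ≤ ε / 2 + (C + ε / 2) := by
      exact add_le_add ha.le h1
    _ = C + ε := by ring

/-! ### Tensor products of operators, and the minimal tensor product -/

section MinTensor

open UniformSpace

section

variable (H K : Type) [NormedAddCommGroup H] [InnerProductSpace ℂ H]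
  [NormedAddCommGroup K] [InnerProductSpace ℂ K]

/-- The Hilbert space tensor product: the completion of the algebraic tensor product for the inner
product `⟪x ⊗ y, x' ⊗ y'⟫ = ⟪x, x'⟫ ⟪y, y'⟫`. -/
def HilbertTensor : Type := Completion (H ⊗[ℂ] K)

instance : NormedAddCommGroup (HilbertTensor H K) :=
  inferInstanceAs (NormedAddCommGroup (Completion (H ⊗[ℂ] K)))
instance : InnerProductSpace ℂ (HilbertTensor H K) :=
  inferInstanceAs (InnerProductSpace ℂ (Completion (H ⊗[ℂ] K)))
instance : CompleteSpace (HilbertTensor H K) :=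
  inferInstanceAs (CompleteSpace (Completion (H ⊗[ℂ] K)))

/-- The isometric embedding of the algebraic tensor product in the Hilbert space tensor product. -/
def HilbertTensor.emb : H ⊗[ℂ] K →ₗᵢ[ℂ] HilbertTensor H K :=
  (Completion.toComplₗᵢ : H ⊗[ℂ] K →ₗᵢ[ℂ] Completion (H ⊗[ℂ] K))

lemma HilbertTensor.denseRange_emb : DenseRange (HilbertTensor.emb H K) :=
  Completion.denseRange_coe

end

section

variable {H K : Type} [NormedAddCommGroup H] [InnerProductSpace ℂ H] [CompleteSpace H]
  [NormedAddCommGroup K] [InnerProductSpace ℂ K] [CompleteSpace K]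

open HilbertTensor

/-- The operator `S ⊗ T` on the Hilbert space tensor product. -/
def opTmul (S : H →L[ℂ] H) (T : K →L[ℂ] K) : HilbertTensor H K →L[ℂ] HilbertTensor H K :=
  ((TensorProduct.mapL S T).completion : Completion (H ⊗[ℂ] K) →L[ℂ] Completion (H ⊗[ℂ] K))

lemma opTmul_emb (S : H →L[ℂ] H) (T : K →L[ℂ] K) (x : H ⊗[ℂ] K) :
    opTmul S T (emb H K x) = emb H K (TensorProduct.mapL S T x) :=
  ContinuousLinearMap.completion_apply_coe _ _

lemma clm_ext_emb {F G : HilbertTensor H K →L[ℂ] HilbertTensor H K}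
    (h : ∀ x : H ⊗[ℂ] K, F (emb H K x) = G (emb H K x)) : F = G := by
  ext x
  exact (denseRange_emb H K).induction_on x (isClosed_eq F.continuous G.continuous) h

lemma opTmul_mul (S S' : H →L[ℂ] H) (T T' : K →L[ℂ] K) :
    opTmul (S * S') (T * T') = opTmul S T * opTmul S' T' := by
  refine clm_ext_emb fun x => ?_
  rw [mul_apply_eq_comp, opTmul_emb, opTmul_emb, opTmul_emb, TensorProduct.mapL_mul,
    mul_apply_eq_comp]

lemma opTmul_one : opTmul (1 : H →L[ℂ] H) (1 : K →L[ℂ] K) = 1 := by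
  refine clm_ext_emb fun x => ?_
  rw [opTmul_emb]
  simp

lemma opTmul_star (S : H →L[ℂ] H) (T : K →L[ℂ] K) :
    star (opTmul S T) = opTmul (star S) (star T) := by
  symm
  rw [ContinuousLinearMap.star_eq_adjoint (opTmul S T), ContinuousLinearMap.eq_adjoint_iff]
  intro x y
  refine (denseRange_emb H K).induction_on₂ ?_ ?_ x y
  · apply isClosed_eq <;> fun_prop
  · intro x y
    rw [opTmul_emb, opTmul_emb, LinearIsometry.inner_map_map, LinearIsometry.inner_map_map]
    induction x using TensorProduct.induction_on with
    | zero => simp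
    | add x x' hx hx' => simp only [map_add, inner_add_left, hx, hx']
    | tmul a b =>
      induction y using TensorProduct.induction_on with
      | zero => simp
      | add x x' hx hx' => simp only [map_add, inner_add_right, hx, hx']
      | tmul c d =>
        rw [TensorProduct.mapL_tmul, TensorProduct.mapL_tmul, TensorProduct.inner_tmul,
          TensorProduct.inner_tmul, ContinuousLinearMap.star_eq_adjoint,
          ContinuousLinearMap.star_eq_adjoint, ContinuousLinearMap.adjoint_inner_left,
          ContinuousLinearMap.adjoint_inner_left]

lemma norm_opTmul_le (S : H →L[ℂ] H) (T : K →L[ℂ] K) : ‖opTmul S T‖ ≤ ‖S‖ * ‖T‖ := by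
  refine ContinuousLinearMap.opNorm_le_bound _ (by positivity) fun x => ?_
  refine (denseRange_emb H K).induction_on x ?_ ?_
  · apply isClosed_le <;> fun_prop
  · intro x
    rw [opTmul_emb, LinearIsometry.norm_map, LinearIsometry.norm_map]
    exact (ContinuousLinearMap.le_opNorm _ _).trans
      (mul_le_mul_of_nonneg_right (TensorProduct.norm_mapL_le S T) (norm_nonneg _))

/-- `opTmul` as a bilinear map. -/
def opTmulBilin : (H →L[ℂ] H) →ₗ[ℂ] (K →L[ℂ] K) →ₗ[ℂ]
    (HilbertTensor H K →L[ℂ] HilbertTensor H K) :=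
  LinearMap.mk₂ ℂ opTmul
    (fun S S' T => clm_ext_emb fun x => by
      simp only [opTmul_emb, add_apply, TensorProduct.mapL_add_left,
        map_add])
    (fun c S T => clm_ext_emb fun x => by
      simp only [opTmul_emb, smul_apply, TensorProduct.mapL_smul_left,
        map_smul])
    (fun S T T' => clm_ext_emb fun x => by
      simp only [opTmul_emb, add_apply, TensorProduct.mapL_add_right,
        map_add])
    (fun c S T => clm_ext_emb fun x => by
      simp only [opTmul_emb, smul_apply, TensorProduct.mapL_smul_right,
        map_smul])

end

variable {A B : Type} [CStarAlgebra A] [CStarAlgebra B]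

/-- The linear map `ρ ⊗ σ` on the algebraic tensor product of two algebras, with values in the
operators on the Hilbert space tensor product. -/
def repTensorLin (r : OpRep A) (s : OpRep B) :
    A ⊗[ℂ] B →ₗ[ℂ] (HilbertTensor r.H s.H →L[ℂ] HilbertTensor r.H s.H) :=
  TensorProduct.lift
    (opTmulBilin.compl₁₂ (r.ρ.toAlgHom.toLinearMap) (s.ρ.toAlgHom.toLinearMap))

lemma repTensorLin_tmul (r : OpRep A) (s : OpRep B) (a : A) (b : B) :
    repTensorLin r s (a ⊗ₜ b) = opTmul (r.ρ a) (s.ρ b) := rfl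

lemma repTensorLin_one (r : OpRep A) (s : OpRep B) : repTensorLin r s 1 = 1 := by
  rw [Algebra.TensorProduct.one_def, repTensorLin_tmul, map_one, map_one, opTmul_one]

lemma repTensorLin_mul (r : OpRep A) (s : OpRep B) (x y : A ⊗[ℂ] B) :
    repTensorLin r s (x * y) = repTensorLin r s x * repTensorLin r s y := by
  induction x using TensorProduct.induction_on with
  | zero => rw [zero_mul, LinearMap.map_zero, zero_mul]
  | add x x' hx hx' => rw [add_mul, LinearMap.map_add, LinearMap.map_add, hx, hx', add_mul]
  | tmul a b =>
    induction y using TensorProduct.induction_on with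
    | zero => rw [mul_zero, LinearMap.map_zero, mul_zero]
    | add x x' hx hx' => rw [mul_add, LinearMap.map_add, LinearMap.map_add, hx, hx', mul_add]
    | tmul c d =>
      rw [Algebra.TensorProduct.tmul_mul_tmul, repTensorLin_tmul, repTensorLin_tmul,
        repTensorLin_tmul, map_mul, map_mul, opTmul_mul]

lemma repTensorLin_star (r : OpRep A) (s : OpRep B) (x : A ⊗[ℂ] B) :
    repTensorLin r s (star x) = star (repTensorLin r s x) := by
  induction x using TensorProduct.induction_on with
  | zero => rw [star_zero, LinearMap.map_zero, star_zero]
  | add x x' hx hx' => rw [star_add, LinearMap.map_add, LinearMap.map_add, hx, hx', star_add]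
  | tmul a b =>
    rw [TensorProduct.star_tmul, repTensorLin_tmul, repTensorLin_tmul, map_star, map_star,
      opTmul_star]

/-- The representation `ρ ⊗ σ` of the algebraic tensor product on the Hilbert space tensor product,
`(ρ ⊗ σ)(a ⊗ b) = ρ(a) ⊗ σ(b)`. -/
def repTensor (r : OpRep A) (s : OpRep B) : OpRep (A ⊗[ℂ] B) where
  H := HilbertTensor r.H s.H
  ρ :=
    { toFun := repTensorLin r s
      map_one' := repTensorLin_one r s
      map_mul' := repTensorLin_mul r s
      map_zero' := LinearMap.map_zero _
      map_add' := LinearMap.map_add _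
      commutes' := fun c => by
        rw [Algebra.algebraMap_eq_smul_one, Algebra.algebraMap_eq_smul_one, LinearMap.map_smul,
          repTensorLin_one]
      map_star' := repTensorLin_star r s }

lemma repTensor_tmul (r : OpRep A) (s : OpRep B) (a : A) (b : B) :
    (repTensor r s).ρ (a ⊗ₜ b) = opTmul (r.ρ a) (s.ρ b) := rfl

variable (A B)

/-- The representations `ρ ⊗ σ` of the algebraic tensor product. -/
def minReps : Set (OpRep (A ⊗[ℂ] B)) :=
  {t | ∃ (r : OpRep A) (s : OpRep B), t = repTensor r s}

lemma minReps_bdd (z : A ⊗[ℂ] B) :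
    BddAbove (Set.range fun t : minReps A B => ‖t.1.ρ z‖) := by
  induction z using TensorProduct.induction_on with
  | zero => exact ⟨0, by rintro _ ⟨t, rfl⟩; simp⟩
  | add x y hx hy =>
    obtain ⟨C, hC⟩ := hx
    obtain ⟨D, hD⟩ := hy
    refine ⟨C + D, ?_⟩
    rintro _ ⟨t, rfl⟩
    dsimp only
    rw [map_add]
    exact (norm_add_le _ _).trans (add_le_add (hC ⟨t, rfl⟩) (hD ⟨t, rfl⟩))
  | tmul a b =>
    refine ⟨‖a‖ * ‖b‖, ?_⟩
    rintro _ ⟨⟨_, r, s, rfl⟩, rfl⟩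
    dsimp only
    rw [repTensor_tmul]
    exact (norm_opTmul_le _ _).trans (mul_le_mul (NonUnitalStarAlgHom.norm_apply_le r.ρ a)
      (NonUnitalStarAlgHom.norm_apply_le s.ρ b) (norm_nonneg _) (norm_nonneg _))

/-- The minimal (spatial) C*-norm on the algebraic tensor product:
`‖z‖ = sup ‖(ρ ⊗ σ)(z)‖`, over all representations `ρ` of `A` and `σ` of `B`. -/
def minSeminorm : CStarSeminorm (A ⊗[ℂ] B) :=
  OpRep.supSeminorm (minReps A B) (minReps_bdd A B)

/-- The minimal (spatial) tensor product of two C*-algebras. -/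
abbrev MinTensor : Type := (minSeminorm A B).CStar

variable {A B}

/-- The simple tensor `a ⊗ b` in the minimal tensor product. -/
def MinTensor.tmul (a : A) (b : B) : MinTensor A B := (minSeminorm A B).ι (a ⊗ₜ b)

variable {A' B' : Type} [CStarAlgebra A'] [CStarAlgebra B']

/-- The *-homomorphism `f ⊗ g` between algebraic tensor products. -/
def algTensorMap (f : A →⋆ₐ[ℂ] A') (g : B →⋆ₐ[ℂ] B') : A ⊗[ℂ] B →⋆ₐ[ℂ] A' ⊗[ℂ] B' where
  toAlgHom := Algebra.TensorProduct.map f.toAlgHom g.toAlgHom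
  map_star' x := by
    dsimp only [AlgHom.toRingHom_eq_coe, RingHom.toMonoidHom_eq_coe, OneHom.toFun_eq_coe,
      MonoidHom.toOneHom_coe, MonoidHom.coe_coe, RingHom.coe_coe]
    induction x using TensorProduct.induction_on with
    | zero => simp
    | add x x' hx hx' => rw [star_add, map_add, map_add, hx, hx', star_add]
    | tmul a b =>
      rw [TensorProduct.star_tmul, Algebra.TensorProduct.map_tmul, Algebra.TensorProduct.map_tmul,
        TensorProduct.star_tmul]
      congr 1
      · exact map_star f a
      · exact map_star g b

lemma algTensorMap_tmul (f : A →⋆ₐ[ℂ] A') (g : B →⋆ₐ[ℂ] B') (a : A) (b : B) :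
    algTensorMap f g (a ⊗ₜ b) = f a ⊗ₜ g b := rfl

lemma repTensor_algTensorMap (f : A →⋆ₐ[ℂ] A') (g : B →⋆ₐ[ℂ] B') (r : OpRep A') (s : OpRep B')
    (z : A ⊗[ℂ] B) :
    (repTensor r s).ρ (algTensorMap f g z) = (repTensor (r.comp f) (s.comp g)).ρ z := by
  induction z using TensorProduct.induction_on with
  | zero => rw [map_zero, map_zero, map_zero]; rfl
  | add x y hx hy => rw [map_add, map_add, map_add, hx, hy]; rfl
  | tmul a b => rfl

lemma minSeminorm_algTensorMap_le (f : A →⋆ₐ[ℂ] A') (g : B →⋆ₐ[ℂ] B') (z : A ⊗[ℂ] B) :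
    ‖(minSeminorm A' B').ι (algTensorMap f g z)‖ ≤ (minSeminorm A B).toFun z := by
  rw [CStarSeminorm.norm_ι]
  refine OpRep.supSeminorm_le (Real.iSup_nonneg fun _ => norm_nonneg _) ?_
  rintro _ ⟨r, s, rfl⟩
  rw [repTensor_algTensorMap]
  exact OpRep.le_supSeminorm (S := minReps A B) ⟨r.comp f, s.comp g, rfl⟩ z

/-- The *-homomorphism `f ⊗ g` between minimal tensor products. -/
def MinTensor.map (f : A →⋆ₐ[ℂ] A') (g : B →⋆ₐ[ℂ] B') : MinTensor A B →⋆ₐ[ℂ] MinTensor A' B' :=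
  (minSeminorm A B).lift ((minSeminorm A' B').ι.comp (algTensorMap f g))
    (minSeminorm_algTensorMap_le f g)

lemma MinTensor.map_tmul (f : A →⋆ₐ[ℂ] A') (g : B →⋆ₐ[ℂ] B') (a : A) (b : B) :
    MinTensor.map f g (MinTensor.tmul a b) = MinTensor.tmul (f a) (g b) :=
  CStarSeminorm.lift_ι _ _ _ _

end MinTensor

/-! ### The free complex *-algebra on self-adjoint letters -/

section FreeSA

instance (X : Type) : StarModule ℝ (FreeAlgebra ℝ X) where
  star_smul c a := by
    rw [Algebra.smul_def, star_mul, FreeAlgebra.star_algebraMap, star_trivial c, Algebra.smul_def,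
      Algebra.commutes]

/-- The complex unital *-algebra of noncommutative polynomials in self-adjoint letters `X`: the
complexification of the free real algebra, with the conjugate-linear involution that reverses
words. -/
def FreeSA (X : Type) : Type := ℂ ⊗[ℝ] FreeAlgebra ℝ X

variable {X : Type}

instance : Ring (FreeSA X) := inferInstanceAs (Ring (ℂ ⊗[ℝ] FreeAlgebra ℝ X))
instance : StarRing (FreeSA X) := inferInstanceAs (StarRing (ℂ ⊗[ℝ] FreeAlgebra ℝ X))
instance : Algebra ℂ (FreeSA X) := inferInstanceAs (Algebra ℂ (ℂ ⊗[ℝ] FreeAlgebra ℝ X))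

/-- The polynomial `c w`, where `c` is a scalar and `w` a real polynomial. -/
def FreeSA.mk (c : ℂ) (w : FreeAlgebra ℝ X) : FreeSA X := (c ⊗ₜ[ℝ] w : ℂ ⊗[ℝ] FreeAlgebra ℝ X)

/-- The letters. -/
def FreeSA.gen (x : X) : FreeSA X := FreeSA.mk 1 (FreeAlgebra.ι ℝ x)

lemma FreeSA.star_mk (c : ℂ) (w : FreeAlgebra ℝ X) :
    star (FreeSA.mk c w) = FreeSA.mk (star c) (star w) := rfl

lemma FreeSA.smul_mk (d c : ℂ) (w : FreeAlgebra ℝ X) :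
    d • FreeSA.mk c w = FreeSA.mk (d * c) w := rfl

lemma FreeSA.mk_mul_mk (d c : ℂ) (v w : FreeAlgebra ℝ X) :
    FreeSA.mk d v * FreeSA.mk c w = FreeSA.mk (d * c) (v * w) :=
  Algebra.TensorProduct.tmul_mul_tmul d c v w

lemma FreeSA.mk_add (c : ℂ) (v w : FreeAlgebra ℝ X) :
    FreeSA.mk c (v + w) = FreeSA.mk c v + FreeSA.mk c w := TensorProduct.tmul_add c v w

lemma FreeSA.mk_algebraMap (t : ℝ) : FreeSA.mk 1 (algebraMap ℝ (FreeAlgebra ℝ X) t) =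
    algebraMap ℂ (FreeSA X) t := by
  have : (1 : ℂ) ⊗ₜ[ℝ] (algebraMap ℝ (FreeAlgebra ℝ X) t) = ((t : ℂ) ⊗ₜ[ℝ] (1 : FreeAlgebra ℝ X)) := by
    rw [Algebra.algebraMap_eq_smul_one, ← TensorProduct.smul_tmul]
    simp
  exact this

lemma FreeSA.induction_mk {P : FreeSA X → Prop} (mk : ∀ c w, P (FreeSA.mk c w))
    (add : ∀ a b, P a → P b → P (a + b)) (a : FreeSA X) : P a := by
  refine TensorProduct.induction_on (motive := P) a ?_ mk add
  have := mk 0 0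
  rwa [show FreeSA.mk 0 (0 : FreeAlgebra ℝ X) = 0 from TensorProduct.zero_tmul _ _] at this

lemma FreeSA.induction {P : FreeSA X → Prop} (gen : ∀ x, P (FreeSA.gen x))
    (scalar : ∀ c : ℂ, P (algebraMap ℂ _ c))
    (mul : ∀ a b, P a → P b → P (a * b)) (add : ∀ a b, P a → P b → P (a + b))
    (a : FreeSA X) : P a := by
  have key : ∀ w : FreeAlgebra ℝ X, P (FreeSA.mk 1 w) := by
    intro w
    induction w using FreeAlgebra.induction with
    | grade0 t => rw [FreeSA.mk_algebraMap]; exact scalar _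
    | grade1 x => exact gen x
    | mul v w hv hw =>
      rw [show FreeSA.mk 1 (v * w) = FreeSA.mk 1 v * FreeSA.mk 1 w by
        rw [FreeSA.mk_mul_mk, one_mul]]
      exact mul _ _ hv hw
    | add v w hv hw => rw [FreeSA.mk_add]; exact add _ _ hv hw
  refine FreeSA.induction_mk (fun c w => ?_) add a
  rw [show FreeSA.mk c w = algebraMap ℂ _ c * FreeSA.mk 1 w by
    rw [← Algebra.smul_def, FreeSA.smul_mk, mul_one]]
  exact mul _ _ (scalar c) (key w)

instance : StarModule ℂ (FreeSA X) where
  star_smul d a := by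
    refine FreeSA.induction_mk (P := fun a => star (d • a) = star d • star a)
      (fun c w => ?_) (fun a b ha hb => ?_) a
    · rw [FreeSA.smul_mk, FreeSA.star_mk, FreeSA.star_mk, FreeSA.smul_mk, star_mul']
    · rw [smul_add, star_add, ha, hb, star_add, smul_add]

lemma FreeSA.star_gen (x : X) : star (FreeSA.gen x) = FreeSA.gen x := by
  rw [FreeSA.gen, FreeSA.star_mk, FreeAlgebra.star_ι, star_one]

variable {B : Type} [Ring B] [StarRing B] [Algebra ℂ B] [StarModule ℂ B]

/-- Evaluation of noncommutative polynomials, as a homomorphism of algebras. -/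
def FreeSA.liftAlg (f : X → B) : FreeSA X →ₐ[ℂ] B :=
  AlgHom.liftEquiv ℝ ℂ (FreeAlgebra ℝ X) B (FreeAlgebra.lift ℝ f)

lemma FreeSA.liftAlg_gen (f : X → B) (x : X) : FreeSA.liftAlg f (FreeSA.gen x) = f x := by
  have : FreeSA.liftAlg f (FreeSA.gen x) = (1 : ℂ) • FreeAlgebra.lift ℝ f (FreeAlgebra.ι ℝ x) := rfl
  rw [this, one_smul, FreeAlgebra.lift_ι_apply]

/-- Evaluation of noncommutative polynomials at self-adjoint elements. -/
def FreeSA.lift (f : X → B) (hf : ∀ x, IsSelfAdjoint (f x)) : FreeSA X →⋆ₐ[ℂ] B where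
  toAlgHom := FreeSA.liftAlg f
  map_star' a := by
    change FreeSA.liftAlg f (star a) = star (FreeSA.liftAlg f a)
    refine FreeSA.induction
      (P := fun a => FreeSA.liftAlg f (star a) = star (FreeSA.liftAlg f a)) (fun x => ?_) (fun c => ?_) (fun a b ha hb => ?_)
      (fun a b ha hb => ?_) a
    · rw [FreeSA.star_gen, FreeSA.liftAlg_gen, (hf x).star_eq]
    · rw [← algebraMap_star_comm, AlgHom.commutes, AlgHom.commutes, algebraMap_star_comm]
    · rw [star_mul, map_mul, map_mul, ha, hb, star_mul]
    · rw [star_add, map_add, map_add, ha, hb, star_add]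

lemma FreeSA.lift_gen (f : X → B) (hf : ∀ x, IsSelfAdjoint (f x)) (x : X) :
    FreeSA.lift f hf (FreeSA.gen x) = f x := FreeSA.liftAlg_gen f x

end FreeSA

/-! ### The defining relations -/

section Relations

/-- `u` is orthogonal: the entries are self-adjoint and `uᵗ = u⁻¹`. -/
structure IsOrthogonalMatrix {B m : Type} [Ring B] [StarRing B] [Fintype m] [DecidableEq m]
    (u : Matrix m m B) : Prop where
  selfAdjoint : ∀ i j, IsSelfAdjoint (u i j)
  mul_transpose : u * uᵀ = 1
  transpose_mul : uᵀ * u = 1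

/-- `u` is magic: orthogonal, with entries that are projections. -/
structure IsMagicMatrix {B m : Type} [Ring B] [StarRing B] [Fintype m] [DecidableEq m]
    (u : Matrix m m B) : Prop extends IsOrthogonalMatrix u where
  projection : ∀ i j, IsStarProjection (u i j)

/-- `u` is cubic: orthogonal, with `xy = 0` for distinct entries on the same row or column. -/
structure IsCubicMatrix {B m : Type} [Ring B] [StarRing B] [Fintype m] [DecidableEq m]
    (u : Matrix m m B) : Prop extends IsOrthogonalMatrix u where
  row : ∀ i j l, j ≠ l → u i j * u i l = 0
  col : ∀ i j l, j ≠ l → u j i * u l i = 0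

/-- `u` is bistochastic: orthogonal, with sum `1` on rows and columns. -/
structure IsBistochasticMatrix {B m : Type} [Ring B] [StarRing B] [Fintype m] [DecidableEq m]
    (u : Matrix m m B) : Prop extends IsOrthogonalMatrix u where
  row_sum : ∀ i, ∑ j, u i j = 1
  col_sum : ∀ j, ∑ i, u i j = 1

/-- The names of the four series of free quantum groups `O⁺, S⁺, H⁺, B⁺`. -/
inductive FreeSeries where
  | O | S | H | B

/-- The defining relations of the quantum groups of each of the four series. -/
def FreeSeries.Rel (G : FreeSeries) {B m : Type} [Ring B] [StarRing B] [Fintype m]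
    [DecidableEq m] (u : Matrix m m B) : Prop :=
  match G with
  | .O => IsOrthogonalMatrix u
  | .S => IsMagicMatrix u
  | .H => IsCubicMatrix u
  | .B => IsBistochasticMatrix u

lemma FreeSeries.Rel.orthogonal {G : FreeSeries} {B m : Type} [Ring B] [StarRing B] [Fintype m]
    [DecidableEq m] {u : Matrix m m B} (h : G.Rel u) : IsOrthogonalMatrix u := by
  cases G
  · exact h
  · exact IsMagicMatrix.toIsOrthogonalMatrix h
  · exact IsCubicMatrix.toIsOrthogonalMatrix h
  · exact IsBistochasticMatrix.toIsOrthogonalMatrix h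

variable {B m : Type} [Ring B] [StarRing B] [Fintype m] [DecidableEq m]

lemma IsOrthogonalMatrix.row_mul {u : Matrix m m B} (h : IsOrthogonalMatrix u) (i j : m) :
    ∑ l, u i l * u j l = if i = j then 1 else 0 := by
  have := congrFun (congrFun h.mul_transpose i) j
  rwa [Matrix.mul_apply, Matrix.one_apply] at this

lemma IsOrthogonalMatrix.col_mul {u : Matrix m m B} (h : IsOrthogonalMatrix u) (i j : m) :
    ∑ l, u l i * u l j = if i = j then 1 else 0 := by
  have := congrFun (congrFun h.transpose_mul i) j
  rwa [Matrix.mul_apply, Matrix.one_apply] at this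

lemma IsOrthogonalMatrix.of_entries {u : Matrix m m B} (h0 : ∀ i j, IsSelfAdjoint (u i j))
    (h1 : ∀ i j, ∑ l, u i l * u j l = if i = j then 1 else 0)
    (h2 : ∀ i j, ∑ l, u l i * u l j = if i = j then 1 else 0) : IsOrthogonalMatrix u where
  selfAdjoint := h0
  mul_transpose := by ext i j; rw [Matrix.mul_apply, Matrix.one_apply]; exact h1 i j
  transpose_mul := by ext i j; rw [Matrix.mul_apply, Matrix.one_apply]; exact h2 i j

/-- The relations are preserved by *-homomorphisms. -/
lemma FreeSeries.Rel.map {G : FreeSeries} [Algebra ℂ B] {B' : Type} [Ring B'] [StarRing B']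
    [Algebra ℂ B'] {u : Matrix m m B} (h : G.Rel u) (φ : B →⋆ₐ[ℂ] B') :
    G.Rel (fun i j => φ (u i j) : Matrix m m B') := by
  have ho : IsOrthogonalMatrix (fun i j => φ (u i j) : Matrix m m B') := by
    refine .of_entries (fun i j => (h.orthogonal.selfAdjoint i j).map φ) (fun i j => ?_)
      (fun i j => ?_)
    · have := congrArg φ (h.orthogonal.row_mul i j)
      rw [map_sum] at this
      simp only [map_mul] at this
      rw [this]; split_ifs <;> simp
    · have := congrArg φ (h.orthogonal.col_mul i j)
      rw [map_sum] at this
      simp only [map_mul] at this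
      rw [this]; split_ifs <;> simp
  cases G
  · exact ho
  · exact ⟨ho, fun i j => (IsMagicMatrix.projection h i j).map φ⟩
  · refine ⟨ho, fun i j l hjl => ?_, fun i j l hjl => ?_⟩
    · rw [← map_mul, IsCubicMatrix.row h i j l hjl, map_zero]
    · rw [← map_mul, IsCubicMatrix.col h i j l hjl, map_zero]
  · refine ⟨ho, fun i => ?_, fun j => ?_⟩
    · rw [← map_sum, IsBistochasticMatrix.row_sum h i, map_one]
    · rw [← map_sum, IsBistochasticMatrix.col_sum h j, map_one]

/-- The relations are preserved by renaming the indices. -/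
lemma FreeSeries.Rel.submatrix {G : FreeSeries} {m' : Type} [Fintype m'] [DecidableEq m']
    {u : Matrix m m B} (h : G.Rel u) (e : m' ≃ m) : G.Rel (u.submatrix e e) := by
  have ho : IsOrthogonalMatrix (u.submatrix e e) := by
    refine .of_entries (fun i j => h.orthogonal.selfAdjoint _ _) (fun i j => ?_) (fun i j => ?_)
    · simp only [← e.injective.eq_iff (a := i)]
      rw [← h.orthogonal.row_mul, ← e.sum_comp]; rfl
    · simp only [← e.injective.eq_iff (a := i)]
      rw [← h.orthogonal.col_mul, ← e.sum_comp]; rfl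
  cases G
  · exact ho
  · exact ⟨ho, fun i j => IsMagicMatrix.projection h _ _⟩
  · exact ⟨ho, fun i j l hjl => IsCubicMatrix.row h _ _ _ (e.injective.ne hjl),
      fun i j l hjl => IsCubicMatrix.col h _ _ _ (e.injective.ne hjl)⟩
  · refine ⟨ho, fun i => ?_, fun j => ?_⟩
    · rw [← IsBistochasticMatrix.row_sum h (e i), ← e.sum_comp]; rfl
    · rw [← IsBistochasticMatrix.col_sum h (e j), ← e.sum_comp]; rfl

/-- The relations are preserved by `v ↦ diag(v, 1)`. -/
lemma FreeSeries.Rel.fromBlocks {G : FreeSeries} {m' : Type} [Fintype m'] [DecidableEq m']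
    {v : Matrix m m B} (h : G.Rel v) :
    G.Rel (Matrix.fromBlocks v 0 0 (1 : Matrix m' m' B)) := by
  have h1 : ∀ i j : m', IsStarProjection ((1 : Matrix m' m' B) i j) := by
    intro i j
    rw [Matrix.one_apply]
    split_ifs
    · exact IsStarProjection.one _
    · exact IsStarProjection.zero _
  have ho : IsOrthogonalMatrix (Matrix.fromBlocks v 0 0 (1 : Matrix m' m' B)) := by
    refine ⟨?_, ?_, ?_⟩
    · rintro (i | i) (j | j)
      · exact h.orthogonal.selfAdjoint i j
      · exact IsSelfAdjoint.zero _
      · exact IsSelfAdjoint.zero _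
      · exact (h1 i j).isSelfAdjoint
    · simp [Matrix.fromBlocks_transpose, Matrix.fromBlocks_multiply, h.orthogonal.mul_transpose]
    · simp [Matrix.fromBlocks_transpose, Matrix.fromBlocks_multiply, h.orthogonal.transpose_mul]
  cases G
  · exact ho
  · refine ⟨ho, ?_⟩
    rintro (i | i) (j | j)
    · exact IsMagicMatrix.projection h i j
    · exact IsStarProjection.zero _
    · exact IsStarProjection.zero _
    · exact h1 i j
  · refine ⟨ho, ?_, ?_⟩
    · rintro (i | i) (j | j) (l | l) hjl
      · exact IsCubicMatrix.row h i j l (fun e => hjl (congrArg _ e))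
      · simp
      · simp
      · simp
      · simp
      · simp
      · simp
      · have : j ≠ l := fun e => hjl (congrArg _ e)
        simp only [Matrix.fromBlocks_apply₂₂, Matrix.one_apply]
        split_ifs with a b <;> simp_all
    · rintro (i | i) (j | j) (l | l) hjl
      · exact IsCubicMatrix.col h i j l (fun e => hjl (congrArg _ e))
      · simp
      · simp
      · simp
      · simp
      · simp
      · simp
      · have : j ≠ l := fun e => hjl (congrArg _ e)
        simp only [Matrix.fromBlocks_apply₂₂, Matrix.one_apply]
        split_ifs with a b <;> simp_all
  · refine ⟨ho, ?_, ?_⟩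
    · rintro (i | i)
      · simp [Fintype.sum_sum_type, IsBistochasticMatrix.row_sum h i]
      · simp [Fintype.sum_sum_type, Matrix.one_apply]
    · rintro (i | i)
      · simp [Fintype.sum_sum_type, IsBistochasticMatrix.col_sum h i]
      · simp [Fintype.sum_sum_type, Matrix.one_apply]

/-- In a C*-algebra, projections with sum `1` are pairwise orthogonal. -/
lemma mul_eq_zero_of_sum_eq_one {A : Type} [CStarAlgebra A] (p : m → A)
    (hp : ∀ i, IsStarProjection (p i)) (hs : ∑ i, p i = 1) {i j : m} (hij : i ≠ j) :
    p i * p j = 0 := by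
  let _ := CStarAlgebra.spectralOrder A
  let _ := CStarAlgebra.spectralOrderedRing A
  have h1 : ∑ l, star (p l * p j) * (p l * p j) = p j := by
    have : ∀ l, star (p l * p j) * (p l * p j) = p j * p l * p j := fun l => by
      rw [star_mul, (hp l).isSelfAdjoint.star_eq, (hp j).isSelfAdjoint.star_eq, mul_assoc,
        ← mul_assoc (p l), (hp l).isIdempotentElem.eq, mul_assoc]
    simp_rw [this]
    rw [← Finset.sum_mul, ← Finset.mul_sum, hs, mul_one, (hp j).isIdempotentElem.eq]
  rw [← Finset.add_sum_erase _ _ (Finset.mem_univ j), (hp j).isIdempotentElem.eq,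
    (hp j).isSelfAdjoint.star_eq, (hp j).isIdempotentElem.eq, add_eq_left,
    Finset.sum_eq_zero_iff_of_nonneg (fun l _ => star_mul_self_nonneg _)] at h1
  exact CStarRing.star_mul_self_eq_zero_iff _ |>.1
    (h1 i (Finset.mem_erase.2 ⟨hij, Finset.mem_univ i⟩))

/-- The relations are preserved by the product `(u, v) ↦ (∑ₛ uᵢₛ ⊗ vₛⱼ)`. -/
lemma FreeSeries.Rel.tensor {G : FreeSeries} {A A' : Type} [CStarAlgebra A] [CStarAlgebra A']
    {u : Matrix m m A} {v : Matrix m m A'} (hu : G.Rel u) (hv : G.Rel v) :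
    G.Rel (fun i j => ∑ s, u i s ⊗ₜ[ℂ] v s j : Matrix m m (A ⊗[ℂ] A')) := by
  have hm : ∀ i j i' j', (∑ s, u i s ⊗ₜ[ℂ] v s j) * (∑ s, u i' s ⊗ₜ[ℂ] v s j') =
      ∑ s, ∑ t, (u i s * u i' t) ⊗ₜ[ℂ] (v s j * v t j') := fun i j i' j' => by
    rw [Finset.sum_mul_sum]
    simp only [Algebra.TensorProduct.tmul_mul_tmul]
  have ho : IsOrthogonalMatrix
      (fun i j => ∑ s, u i s ⊗ₜ[ℂ] v s j : Matrix m m (A ⊗[ℂ] A')) := by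
    refine .of_entries (fun i j => ?_) (fun i j => ?_) (fun i j => ?_)
    · rw [IsSelfAdjoint, star_sum]
      refine Finset.sum_congr rfl fun s _ => ?_
      rw [TensorProduct.star_tmul, (hu.orthogonal.selfAdjoint i s).star_eq,
        (hv.orthogonal.selfAdjoint s j).star_eq]
    · simp only [hm]
      rw [Finset.sum_comm]
      have : ∀ s, ∑ l, ∑ t, (u i s * u j t) ⊗ₜ[ℂ] (v s l * v t l) =
          (u i s * u j s) ⊗ₜ[ℂ] (1 : A') := fun s => by
        rw [Finset.sum_comm]
        simp only [← TensorProduct.tmul_sum, hv.orthogonal.row_mul]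
        rw [Finset.sum_eq_single s] <;> simp +contextual [eq_comm]
      simp only [this]
      rw [← TensorProduct.sum_tmul, hu.orthogonal.row_mul]
      split_ifs
      · rfl
      · simp
    · simp only [hm]
      rw [Finset.sum_comm]
      have : ∀ s, ∑ l, ∑ t, (u l s * u l t) ⊗ₜ[ℂ] (v s i * v t j) =
          (1 : A) ⊗ₜ[ℂ] (v s i * v s j) := fun s => by
        rw [Finset.sum_comm]
        simp only [← TensorProduct.sum_tmul, hu.orthogonal.col_mul]
        rw [Finset.sum_eq_single s] <;> simp +contextual [eq_comm]
      simp only [this]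
      rw [← TensorProduct.tmul_sum, hv.orthogonal.col_mul]
      split_ifs
      · rfl
      · simp
  cases G
  · exact ho
  · refine ⟨ho, fun i j => ⟨?_, ho.selfAdjoint i j⟩⟩
    have hp := IsMagicMatrix.projection hu
    have hq := IsMagicMatrix.projection hv
    have hsum : ∑ s, u i s = 1 := by
      have := hu.orthogonal.row_mul i i
      simpa only [(hp _ _).isIdempotentElem.eq, if_true] using this
    rw [IsIdempotentElem, hm]
    refine Finset.sum_congr rfl fun s _ => ?_
    rw [Finset.sum_eq_single s, (hp i s).isIdempotentElem.eq, (hq s j).isIdempotentElem.eq]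
    · intro t _ hts
      rw [mul_eq_zero_of_sum_eq_one (u i) (hp i) hsum hts.symm, TensorProduct.zero_tmul]
    · simp
  · refine ⟨ho, fun i j l hjl => ?_, fun i j l hjl => ?_⟩
    · rw [hm]
      refine Finset.sum_eq_zero fun s _ => Finset.sum_eq_zero fun t _ => ?_
      by_cases hst : s = t
      · rw [hst, IsCubicMatrix.row hv t j l hjl, TensorProduct.tmul_zero]
      · rw [IsCubicMatrix.row hu i s t hst, TensorProduct.zero_tmul]
    · rw [hm]
      refine Finset.sum_eq_zero fun s _ => Finset.sum_eq_zero fun t _ => ?_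
      by_cases hst : s = t
      · rw [hst, IsCubicMatrix.col hu t j l hjl, TensorProduct.zero_tmul]
      · rw [IsCubicMatrix.col hv i s t hst, TensorProduct.tmul_zero]
  · refine ⟨ho, fun i => ?_, fun j => ?_⟩
    · rw [Finset.sum_comm]
      simp only [← TensorProduct.tmul_sum, IsBistochasticMatrix.row_sum hv]
      rw [← TensorProduct.sum_tmul, IsBistochasticMatrix.row_sum hu]; rfl
    · rw [Finset.sum_comm]
      simp only [← TensorProduct.sum_tmul, IsBistochasticMatrix.col_sum hu]
      rw [← TensorProduct.tmul_sum, IsBistochasticMatrix.col_sum hv]; rfl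

end Relations

/-! ### The quantum groups `Gₙ` and their homogeneous spaces -/

namespace FreeSeries

variable (G : FreeSeries) (n : ℕ)

/-- The representations of the free *-algebra on letters `uᵢⱼ`, `1 ≤ i, j ≤ n`, that satisfy the
defining relations of `Gₙ`. -/
def reps : Set (OpRep (FreeSA (Fin n × Fin n))) :=
  {r | G.Rel (fun i j => r.ρ (FreeSA.gen (i, j)) : Matrix (Fin n) (Fin n) (r.H →L[ℂ] r.H))}

lemma norm_entry_le_one {H m : Type} [NormedAddCommGroup H] [InnerProductSpace ℂ H]
    [CompleteSpace H] [Fintype m] [DecidableEq m] {u : Matrix m m (H →L[ℂ] H)}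
    (h : IsOrthogonalMatrix u) (i j : m) : ‖u i j‖ ≤ 1 := by
  refine ContinuousLinearMap.opNorm_le_bound _ zero_le_one fun x => ?_
  rw [one_mul]
  refine le_of_sq_le_sq ?_ (norm_nonneg x)
  have key : ∀ l, ‖u i l x‖ ^ 2 = RCLike.re (inner ℂ ((u i l * u i l) x) x) := fun l => by
    rw [mul_apply_eq_comp, ← (ContinuousLinearMap.isSelfAdjoint_iff'.1 (h.selfAdjoint i l)),
      ContinuousLinearMap.adjoint_inner_left,
      (ContinuousLinearMap.isSelfAdjoint_iff'.1 (h.selfAdjoint i l)),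
      inner_self_eq_norm_sq]
  calc ‖u i j x‖ ^ 2 ≤ ∑ l, ‖u i l x‖ ^ 2 :=
        Finset.single_le_sum (f := fun l => ‖u i l x‖ ^ 2) (fun l _ => sq_nonneg _)
          (Finset.mem_univ j)
    _ = RCLike.re (inner ℂ ((∑ l, u i l * u i l) x) x) := by
        simp only [key, sum_apply, sum_inner, map_sum]
    _ = ‖x‖ ^ 2 := by
        rw [h.row_mul, if_pos rfl, one_apply_eq_self, inner_self_eq_norm_sq]

lemma reps_bdd (a : FreeSA (Fin n × Fin n)) :
    BddAbove (Set.range fun r : G.reps n => ‖r.1.ρ a‖) := by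
  refine FreeSA.induction (P := fun a => BddAbove (Set.range fun r : G.reps n => ‖r.1.ρ a‖))
    (fun x => ?_) (fun c => ?_) (fun a b ha hb => ?_) (fun a b ha hb => ?_) a
  · refine ⟨1, ?_⟩
    rintro _ ⟨⟨r, hr⟩, rfl⟩
    exact norm_entry_le_one (Rel.orthogonal hr) x.1 x.2
  · refine ⟨‖c‖, ?_⟩
    rintro _ ⟨⟨r, hr⟩, rfl⟩
    dsimp only
    rw [AlgHomClass.commutes, Algebra.algebraMap_eq_smul_one, norm_smul]
    exact mul_le_of_le_one_right (norm_nonneg _) ContinuousLinearMap.norm_id_le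
  · obtain ⟨C, hC⟩ := ha
    obtain ⟨D, hD⟩ := hb
    refine ⟨C * D, ?_⟩
    rintro _ ⟨t, rfl⟩
    dsimp only
    rw [map_mul]
    have h1 : ‖t.1.ρ a‖ ≤ C := hC ⟨t, rfl⟩
    exact (norm_mul_le _ _).trans
      (mul_le_mul h1 (hD ⟨t, rfl⟩) (norm_nonneg _) ((norm_nonneg _).trans h1))
  · obtain ⟨C, hC⟩ := ha
    obtain ⟨D, hD⟩ := hb
    refine ⟨C + D, ?_⟩
    rintro _ ⟨t, rfl⟩
    dsimp only
    rw [map_add]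
    exact (norm_add_le _ _).trans (add_le_add (hC ⟨t, rfl⟩) (hD ⟨t, rfl⟩))

/-- The universal C*-norm: the supremum over all the Hilbert space representations of the
defining relations. -/
def univSeminorm : CStarSeminorm (FreeSA (Fin n × Fin n)) :=
  OpRep.supSeminorm (G.reps n) (G.reps_bdd n)

/-- `C(Gₙ)`: the universal unital C*-algebra generated by the entries `uᵢⱼ` of an `n × n` matrix
subject to the defining relations of `Gₙ`. -/
abbrev C : Type := (G.univSeminorm n).CStar

/-- The matrix of standard generators `uᵢⱼ` of `C(Gₙ)`. -/
def u : Matrix (Fin n) (Fin n) (G.C n) := fun i j => (G.univSeminorm n).ι (FreeSA.gen (i, j))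

lemma normedByReps_C : NormedByReps (G.C n) := normedByReps_supSeminorm _ _

lemma ι_eq_of_reps {a b : FreeSA (Fin n × Fin n)} (h : ∀ r ∈ G.reps n, r.ρ a = r.ρ b) :
    (G.univSeminorm n).ι a = (G.univSeminorm n).ι b := by
  rw [← sub_eq_zero, ← map_sub, ← norm_le_zero_iff, CStarSeminorm.norm_ι]
  refine OpRep.supSeminorm_le le_rfl fun r hr => ?_
  rw [map_sub, h r hr, sub_self, norm_zero]

/-- The generators of `C(Gₙ)` satisfy the defining relations. -/
lemma rel_u : G.Rel (G.u n) := by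
  have ho : IsOrthogonalMatrix (G.u n) := by
    refine .of_entries (fun i j => ?_) (fun i j => ?_) (fun i j => ?_)
    · rw [IsSelfAdjoint, u, ← map_star, FreeSA.star_gen]
    · have := G.ι_eq_of_reps n (a := ∑ l, FreeSA.gen (i, l) * FreeSA.gen (j, l))
        (b := if i = j then 1 else 0) fun r hr => by
          rw [map_sum]
          simp only [map_mul]
          rw [(Rel.orthogonal hr).row_mul]; split_ifs <;> simp
      rw [map_sum] at this
      simp only [map_mul] at this
      refine this.trans ?_
      split_ifs <;> simp
    · have := G.ι_eq_of_reps n (a := ∑ l, FreeSA.gen (l, i) * FreeSA.gen (l, j))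
        (b := if i = j then 1 else 0) fun r hr => by
          rw [map_sum]
          simp only [map_mul]
          rw [(Rel.orthogonal hr).col_mul]; split_ifs <;> simp
      rw [map_sum] at this
      simp only [map_mul] at this
      refine this.trans ?_
      split_ifs <;> simp
  cases G
  · exact ho
  · refine ⟨ho, fun i j => ⟨?_, ho.selfAdjoint i j⟩⟩
    rw [IsIdempotentElem, u, ← map_mul]
    refine ι_eq_of_reps _ n fun r hr => ?_
    rw [map_mul]
    exact (IsMagicMatrix.projection hr i j).isIdempotentElem
  · refine ⟨ho, fun i j l hjl => ?_, fun i j l hjl => ?_⟩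
    · rw [u, u, ← map_mul, ← map_zero (univSeminorm _ n).ι]
      refine ι_eq_of_reps _ n fun r hr => ?_
      rw [map_mul, map_zero]
      exact IsCubicMatrix.row hr i j l hjl
    · rw [u, u, ← map_mul, ← map_zero (univSeminorm _ n).ι]
      refine ι_eq_of_reps _ n fun r hr => ?_
      rw [map_mul, map_zero]
      exact IsCubicMatrix.col hr i j l hjl
  · refine ⟨ho, fun i => ?_, fun j => ?_⟩
    · simp only [u]
      rw [← map_sum, ← map_one (univSeminorm _ n).ι]
      refine ι_eq_of_reps _ n fun r hr => ?_
      rw [map_sum, map_one]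
      exact IsBistochasticMatrix.row_sum hr i
    · simp only [u]
      rw [← map_sum, ← map_one (univSeminorm _ n).ι]
      refine ι_eq_of_reps _ n fun r hr => ?_
      rw [map_sum, map_one]
      exact IsBistochasticMatrix.col_sum hr j

variable {G n} {B : Type} [CStarAlgebra B]

/-- Evaluation of noncommutative polynomials at a matrix that satisfies the relations. -/
def evalHom (v : Matrix (Fin n) (Fin n) B) (hv : G.Rel v) : FreeSA (Fin n × Fin n) →⋆ₐ[ℂ] B :=
  FreeSA.lift (fun x => v x.1 x.2) (fun x => hv.orthogonal.selfAdjoint x.1 x.2)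

lemma evalHom_gen (v : Matrix (Fin n) (Fin n) B) (hv : G.Rel v) (i j : Fin n) :
    evalHom v hv (FreeSA.gen (i, j)) = v i j := FreeSA.lift_gen _ _ (i, j)

lemma norm_evalHom_le (hB : NormedByReps B) (v : Matrix (Fin n) (Fin n) B) (hv : G.Rel v)
    (a : FreeSA (Fin n × Fin n)) : ‖evalHom v hv a‖ ≤ (G.univSeminorm n).toFun a := by
  refine hB _ _ (Real.iSup_nonneg fun _ => norm_nonneg _) fun r => ?_
  refine OpRep.le_supSeminorm (S := G.reps n) (r := r.comp (evalHom v hv)) ?_ a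
  have h : G.Rel (fun i j => r.ρ (v i j) : Matrix (Fin n) (Fin n) (r.H →L[ℂ] r.H)) := hv.map r.ρ
  have e : (fun i j => r.ρ (v i j) : Matrix (Fin n) (Fin n) (r.H →L[ℂ] r.H)) =
      fun i j => (r.comp (evalHom v hv)).ρ (FreeSA.gen (i, j)) := by
    funext i j
    exact congrArg r.ρ (evalHom_gen v hv i j).symm
  rw [e] at h
  exact h

/-- The universal property of `C(Gₙ)`: a matrix `v` over a C*-algebra that satisfies the defining
relations gives a *-homomorphism with `uᵢⱼ ↦ vᵢⱼ`. -/
def ofMatrix (hB : NormedByReps B) (v : Matrix (Fin n) (Fin n) B) (hv : G.Rel v) :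
    G.C n →⋆ₐ[ℂ] B :=
  (G.univSeminorm n).lift (evalHom v hv) (norm_evalHom_le hB v hv)

lemma ofMatrix_u (hB : NormedByReps B) (v : Matrix (Fin n) (Fin n) B) (hv : G.Rel v)
    (i j : Fin n) : ofMatrix hB v hv (G.u n i j) = v i j :=
  (CStarSeminorm.lift_ι _ _ _ _).trans (evalHom_gen v hv i j)

variable (G n)

lemma rel_comul : G.Rel (fun i j => ∑ s, MinTensor.tmul (G.u n i s) (G.u n s j) :
    Matrix (Fin n) (Fin n) (MinTensor (G.C n) (G.C n))) := by
  have := ((G.rel_u n).tensor (G.rel_u n)).map (minSeminorm (G.C n) (G.C n)).ι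
  simp only [map_sum] at this
  exact this

/-- The comultiplication `Δ : C(Gₙ) → C(Gₙ) ⊗ C(Gₙ)`, `Δ(uᵢⱼ) = ∑ₛ uᵢₛ ⊗ uₛⱼ`. -/
def comul : G.C n →⋆ₐ[ℂ] MinTensor (G.C n) (G.C n) :=
  ofMatrix (normedByReps_supSeminorm _ _)
    (fun i j => ∑ s, MinTensor.tmul (G.u n i s) (G.u n s j)) (G.rel_comul n)

lemma comul_u (i j : Fin n) :
    G.comul n (G.u n i j) = ∑ s, MinTensor.tmul (G.u n i s) (G.u n s j) :=
  ofMatrix_u _ _ _ i j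

variable {n} {k : ℕ} (hk : k ≤ n)

/-- The splitting of `{1, …, n}` into the first `k` indices and the last `n - k` ones. -/
def splitIndex (hk : k ≤ n) : Fin n ≃ Fin k ⊕ Fin (n - k) :=
  (finCongr (Nat.add_sub_cancel' hk).symm).trans finSumFinEquiv.symm

/-- The `n × n` matrix `diag(v, 1ₙ₋ₖ)`. -/
def diagOne {B : Type} [Ring B] (hk : k ≤ n) (v : Matrix (Fin k) (Fin k) B) :
    Matrix (Fin n) (Fin n) B :=
  (Matrix.fromBlocks v 0 0 1).submatrix (splitIndex hk) (splitIndex hk)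

/-- The restriction map `π : C(Gₙ) → C(Gₖ)`, `u ↦ diag(v, 1ₙ₋ₖ)`, of the embedding `Gₖ ⊂ Gₙ`. -/
def restrict : G.C n →⋆ₐ[ℂ] G.C k :=
  ofMatrix (G.normedByReps_C k) (diagOne hk (G.u k)) ((G.rel_u k).fromBlocks.submatrix _)

lemma restrict_u (i j : Fin n) : G.restrict hk (G.u n i j) = diagOne hk (G.u k) i j :=
  ofMatrix_u _ _ _ i j

/-- The coaction `α = (π ⊗ id)Δ : C(Gₙ) → C(Gₖ) ⊗ C(Gₙ)`. -/
def coaction : G.C n →⋆ₐ[ℂ] MinTensor (G.C k) (G.C n) :=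
  (MinTensor.map (G.restrict hk) (StarAlgHom.id ℂ (G.C n))).comp (G.comul n)

/-- The *-homomorphism `f ↦ 1 ⊗ f`. -/
def trivialCoaction (k n : ℕ) : G.C n →⋆ₐ[ℂ] MinTensor (G.C k) (G.C n) where
  toFun f := MinTensor.tmul 1 f
  map_one' := map_one (minSeminorm (G.C k) (G.C n)).ι
  map_mul' a b := by
    rw [MinTensor.tmul, MinTensor.tmul, MinTensor.tmul, ← map_mul,
      Algebra.TensorProduct.tmul_mul_tmul, mul_one]
  map_zero' := by rw [MinTensor.tmul, TensorProduct.tmul_zero, map_zero]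
  map_add' a b := by
    rw [MinTensor.tmul, MinTensor.tmul, MinTensor.tmul, ← map_add, TensorProduct.tmul_add]
  commutes' c := by
    rw [MinTensor.tmul, Algebra.algebraMap_eq_smul_one, TensorProduct.tmul_smul, map_smul,
      ← Algebra.TensorProduct.one_def, map_one, Algebra.algebraMap_eq_smul_one]
  map_star' a := by
    rw [MinTensor.tmul, MinTensor.tmul, ← map_star, TensorProduct.star_tmul, star_one]

/-- `C(Gₙ/Gₖ) = {f ∈ C(Gₙ) | (π ⊗ id)Δ f = 1 ⊗ f}`. -/
def quotientAlgebra : StarSubalgebra ℂ (G.C n) :=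
  StarAlgHom.equalizer (G.coaction hk) (G.trivialCoaction k n)

/-- `C_×(Gₙ/Gₖ)`: the (unital) C*-subalgebra of `C(Gₙ)` generated by the last `n - k` rows of
generators, that is by the `uᵢⱼ` with `i > k` (`k ≤ i` when rows are counted from `0`). -/
def rowAlgebra (n k : ℕ) : StarSubalgebra ℂ (G.C n) :=
  (StarAlgebra.adjoin ℂ {f : G.C n | ∃ i j : Fin n, k ≤ (i : ℕ) ∧ f = G.u n i j}).topologicalClosure

lemma diagOne_of_le {B : Type} [Ring B] (hk : k ≤ n) (v : Matrix (Fin k) (Fin k) B)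
    {i : Fin n} (hi : k ≤ (i : ℕ)) (j : Fin n) : diagOne hk v i j = if i = j then 1 else 0 := by
  obtain ⟨i, rfl⟩ := (splitIndex hk).symm.surjective i
  obtain ⟨j, rfl⟩ := (splitIndex hk).symm.surjective j
  simp only [diagOne, Matrix.submatrix_apply, Equiv.apply_symm_apply, EmbeddingLike.apply_eq_iff_eq]
  rcases i with i | i
  · exact absurd hi (by simp [splitIndex])
  · rcases j with j | j <;> simp [Matrix.one_apply]

lemma coaction_u_of_le {i : Fin n} (hi : k ≤ (i : ℕ)) (j : Fin n) :
    G.coaction hk (G.u n i j) = G.trivialCoaction k n (G.u n i j) := by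
  have e : G.coaction hk (G.u n i j) =
      MinTensor.map (G.restrict hk) (StarAlgHom.id ℂ (G.C n)) (G.comul n (G.u n i j)) := rfl
  rw [e, comul_u, map_sum]
  simp only [MinTensor.map_tmul, restrict_u]
  rw [Finset.sum_eq_single i]
  · rw [diagOne_of_le hk _ hi, if_pos rfl]; rfl
  · intro s _ hs
    rw [diagOne_of_le hk _ hi, if_neg hs.symm, MinTensor.tmul, TensorProduct.zero_tmul, map_zero]
  · simp

lemma continuous_starAlgHom {A B : Type} [CStarAlgebra A] [CStarAlgebra B] (φ : A →⋆ₐ[ℂ] B) :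
    Continuous φ :=
  (NonUnitalStarAlgHom.instContinuousLinearMapClassComplex.map_continuous φ)

/-- The inclusion `C_×(Gₙ/Gₖ) ⊂ C(Gₙ/Gₖ)`. -/
lemma rowAlgebra_le_quotientAlgebra : G.rowAlgebra n k ≤ G.quotientAlgebra hk := by
  refine StarSubalgebra.topologicalClosure_minimal (StarAlgebra.adjoin_le ?_) ?_
  · rintro _ ⟨i, j, hi, rfl⟩
    exact G.coaction_u_of_le hk hi j
  · exact isClosed_eq (continuous_starAlgHom _) (continuous_starAlgHom _)

end FreeSeries

end

/-! The inclusion is injective for free, so everything rests on `C(Gₙ/Gₖ) ≤ C_×(Gₙ/Gₖ)`. Three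
mechanisms give it.

Either the rows below `k` already generate `C(Gₙ)`. This is clear for `k = 0`. For `k = 1` only the
first row is missing, and when the columns of `u` sum to `1` (a relation for `B⁺`, a consequence of
idempotency for `S⁺`) each of its entries is `1` minus the rest of its column
(`rowAlgebra_one_eq_top`).

Or `k = n`: then `π = id` and invariance reads `Δf = 1 ⊗ f`. Applying `id ⊗ ε` gives `f ⊗ 1 = 1 ⊗
ε(f)`, so `f` is the scalar `ε(f)` (`quotientAlgebra_self_le`). The case `n = 1` is `k = 0` or `k =
n`.

Or `G = S⁺` and `(k, n) = (2, 3)`. The entries of a `3 × 3` magic matrix commute (`commute_three`),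
so this is classical: `C(S₃⁺)` consists of functions on `S₃`. Write `R` for the algebra of the last
row and `σ` for the exchange of the first two rows. The last row records where one point goes, and
the parity `w` (`evenPart`) determines the rest, so polynomials lie in `R + Rw`
(`exists_eq_add_mul_evenPart`). Now `σ` fixes `R` and `w + σ(w) = 1`, hence `(a + bw) + σ(a + bw) =
2a + b` is in `R`; by density `f + σ(f)` is in `R` for every `f`. Pairing the coaction with the
transposition, a character of `C(S₂⁺)`, shows that an invariant `f` satisfies `σ(f) = f`
(`swapRows_eq_self`), so `2f` is in `R`.

Both uses of a character land in a tensor product with `ℂ`; the injectivity of `a ↦ a ⊗ 1` and `a ↦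
1 ⊗ a` brings the identities back to `C(Gₙ)`. -/

noncomputable section

/-! ### Scalars and simple tensors in the minimal tensor product -/

/-- The representation of `ℂ` on itself by multiplication. -/
def scalarRep : OpRep ℂ where
  H := ℂ
  ρ :=
    { Algebra.ofId ℂ (ℂ →L[ℂ] ℂ) with
      map_star' := fun c => by
        change algebraMap ℂ (ℂ →L[ℂ] ℂ) (star c) = star (algebraMap ℂ (ℂ →L[ℂ] ℂ) c)
        exact algebraMap_star_comm c }

/-- Multiplication by `b` on `ℂ` has norm `‖b‖`. This makes `ℂ` a legitimate target for `ofMatrix`,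
and so provides characters of `C(Gₙ)`. -/
lemma normedByReps_complex : NormedByReps ℂ := by
  intro b C _ h
  exact (norm_algebraMap' (ℂ →L[ℂ] ℂ) b).symm.trans_le (h scalarRep)

section Injectivity

variable {A : Type} [CStarAlgebra A]

lemma norm_repTensor_le {B : Type} [CStarAlgebra B] (r : OpRep A) (s : OpRep B) (z : A ⊗[ℂ] B) :
    ‖(repTensor r s).ρ z‖ ≤ ‖(minSeminorm A B).ι z‖ := by
  rw [CStarSeminorm.norm_ι]
  exact OpRep.le_supSeminorm (S := minReps A B) ⟨r, s, rfl⟩ z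

/-- If `S x` and `T y` are nonzero, the image `S x ⊗ T y` of `x ⊗ y` has norm `‖S x‖ ‖T y‖ ≠ 0`. -/
lemma opTmul_eq_zero {H K : Type} [NormedAddCommGroup H] [InnerProductSpace ℂ H] [CompleteSpace H]
    [NormedAddCommGroup K] [InnerProductSpace ℂ K] [CompleteSpace K]
    {S : H →L[ℂ] H} {T : K →L[ℂ] K} (h : opTmul S T = 0) : S = 0 ∨ T = 0 := by
  by_contra! hc
  obtain ⟨x, hx⟩ : ∃ x, S x ≠ 0 := by
    by_contra! h0
    exact hc.1 (ContinuousLinearMap.ext h0)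
  obtain ⟨y, hy⟩ : ∃ y, T y ≠ 0 := by
    by_contra! h0
    exact hc.2 (ContinuousLinearMap.ext h0)
  have e := opTmul_emb S T (x ⊗ₜ y)
  rw [h, TensorProduct.mapL_tmul, zero_apply] at e
  have := congrArg norm e
  rw [norm_zero, LinearIsometry.norm_map, TensorProduct.norm_tmul] at this
  exact mul_ne_zero (norm_ne_zero_iff.2 hx) (norm_ne_zero_iff.2 hy) this.symm

/-- In the minimal tensor product of C*-algebras with enough representations, a simple tensor
vanishes only if one of its factors does. -/
lemma MinTensor.tmul_eq_zero {B : Type} [CStarAlgebra B] (hA : NormedByReps A)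
    (hB : NormedByReps B) {a : A} {b : B} (h : MinTensor.tmul a b = 0) : a = 0 ∨ b = 0 := by
  have key : ∀ (r : OpRep A) (s : OpRep B), r.ρ a = 0 ∨ s.ρ b = 0 := fun r s => by
    refine opTmul_eq_zero ?_
    refine norm_le_zero_iff.1 ((norm_repTensor_le r s (a ⊗ₜ b)).trans ?_)
    rw [show (minSeminorm A B).ι (a ⊗ₜ b) = 0 from h, norm_zero]
  -- In `key` the vanishing factor may depend on the pair; but a single `r` with `r.ρ a ≠ 0` forces
  -- every `s` to kill `b`.
  by_cases ha : ∀ r : OpRep A, r.ρ a = 0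
  · exact .inl (norm_le_zero_iff.1 (hA a 0 le_rfl fun r => by rw [ha r, norm_zero]))
  · obtain ⟨r, hr⟩ := not_forall.1 ha
    exact .inr (norm_le_zero_iff.1 (hB b 0 le_rfl fun s => by
      rw [(key r s).resolve_left hr, norm_zero]))

/-- Used to cancel the scalar leg left over after a counit has been applied to the second leg. -/
lemma MinTensor.tmul_one_injective (hA : NormedByReps A) :
    Function.Injective fun a : A => (MinTensor.tmul a (1 : ℂ)) := by
  intro a b h
  have : MinTensor.tmul (a - b) (1 : ℂ) = 0 := by
    rw [MinTensor.tmul, TensorProduct.sub_tmul, map_sub]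
    exact sub_eq_zero.2 h
  exact sub_eq_zero.1 ((tmul_eq_zero hA normedByReps_complex this).resolve_right one_ne_zero)

/-- Used to cancel the scalar leg left over after a character has been applied to the first leg. -/
lemma MinTensor.one_tmul_injective (hA : NormedByReps A) :
    Function.Injective fun a : A => (MinTensor.tmul (1 : ℂ) a) := by
  intro a b h
  have : MinTensor.tmul (1 : ℂ) (a - b) = 0 := by
    rw [MinTensor.tmul, TensorProduct.tmul_sub, map_sub]
    exact sub_eq_zero.2 h
  exact sub_eq_zero.1 ((tmul_eq_zero normedByReps_complex hA this).resolve_left one_ne_zero)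

lemma MinTensor.smul_tmul {B : Type} [CStarAlgebra B] (c : ℂ) (a : A) (b : B) :
    MinTensor.tmul (c • a) b = MinTensor.tmul a (c • b) := by
  rw [MinTensor.tmul, MinTensor.tmul, TensorProduct.smul_tmul]

/-- The *-homomorphism `a ↦ a ⊗ 1`. -/
def MinTensor.inclLeft (A B : Type) [CStarAlgebra A] [CStarAlgebra B] : A →⋆ₐ[ℂ] MinTensor A B where
  toFun a := MinTensor.tmul a 1
  map_one' := map_one (minSeminorm A B).ι
  map_mul' a b := by
    rw [MinTensor.tmul, MinTensor.tmul, MinTensor.tmul, ← map_mul,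
      Algebra.TensorProduct.tmul_mul_tmul, mul_one]
  map_zero' := by rw [MinTensor.tmul, TensorProduct.zero_tmul, map_zero]
  map_add' a b := by
    rw [MinTensor.tmul, MinTensor.tmul, MinTensor.tmul, ← map_add, TensorProduct.add_tmul]
  commutes' c := by
    rw [MinTensor.tmul, Algebra.algebraMap_eq_smul_one, ← TensorProduct.smul_tmul', map_smul,
      ← Algebra.TensorProduct.one_def, map_one, Algebra.algebraMap_eq_smul_one]
  map_star' a := by
    rw [MinTensor.tmul, MinTensor.tmul, ← map_star, TensorProduct.star_tmul, star_one]

/-- The *-homomorphism `b ↦ 1 ⊗ b`. -/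
def MinTensor.inclRight (A B : Type) [CStarAlgebra A] [CStarAlgebra B] :
    B →⋆ₐ[ℂ] MinTensor A B where
  toFun b := MinTensor.tmul 1 b
  map_one' := map_one (minSeminorm A B).ι
  map_mul' a b := by
    rw [MinTensor.tmul, MinTensor.tmul, MinTensor.tmul, ← map_mul,
      Algebra.TensorProduct.tmul_mul_tmul, mul_one]
  map_zero' := by rw [MinTensor.tmul, TensorProduct.tmul_zero, map_zero]
  map_add' a b := by
    rw [MinTensor.tmul, MinTensor.tmul, MinTensor.tmul, ← map_add, TensorProduct.tmul_add]
  commutes' c := by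
    rw [MinTensor.tmul, Algebra.algebraMap_eq_smul_one, TensorProduct.tmul_smul, map_smul,
      ← Algebra.TensorProduct.one_def, map_one, Algebra.algebraMap_eq_smul_one]
  map_star' a := by
    rw [MinTensor.tmul, MinTensor.tmul, ← map_star, TensorProduct.star_tmul, star_one]

end Injectivity

namespace FreeSeries

/-! ### Density of the polynomials in the generators -/

section Generators

variable {G : FreeSeries} {n : ℕ}

/-- A closed subset of `C(Gₙ)` that contains the polynomials in the generators is everything. -/
lemma C_induction {P : G.C n → Prop} (hP : IsClosed {f | P f}) (gen : ∀ i j, P (G.u n i j))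
    (scalar : ∀ c : ℂ, P (algebraMap ℂ _ c)) (mul : ∀ a b, P a → P b → P (a * b))
    (add : ∀ a b, P a → P b → P (a + b)) (f : G.C n) : P f := by
  refine (G.univSeminorm n).denseRange_ι.induction_on f hP fun a => ?_
  refine FreeSA.induction (P := fun a => P ((G.univSeminorm n).ι a)) (fun x => gen x.1 x.2)
    (fun c => ?_) (fun a b ha hb => ?_) (fun a b ha hb => ?_) a
  · rw [AlgHomClass.commutes]; exact scalar c
  · rw [map_mul]; exact mul _ _ ha hb
  · rw [map_add]; exact add _ _ ha hb

lemma starAlgHom_ext {B : Type} [CStarAlgebra B] {φ ψ : G.C n →⋆ₐ[ℂ] B}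
    (h : ∀ i j, φ (G.u n i j) = ψ (G.u n i j)) : φ = ψ := by
  refine StarAlgHom.ext fun f => C_induction (P := fun f => φ f = ψ f)
    (isClosed_eq (continuous_starAlgHom _) (continuous_starAlgHom _)) h (fun c => ?_)
    (fun a b ha hb => ?_) (fun a b ha hb => ?_) f
  · rw [AlgHomClass.commutes, AlgHomClass.commutes]
  · rw [map_mul, map_mul, ha, hb]
  · rw [map_add, map_add, ha, hb]

lemma eq_top_of_isClosed {S : StarSubalgebra ℂ (G.C n)} (hS : IsClosed (S : Set (G.C n)))
    (h : ∀ i j, G.u n i j ∈ S) : S = ⊤ :=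
  eq_top_iff.2 fun f _ => C_induction (P := fun f => f ∈ S) hS h
    (fun c => algebraMap_mem S c) (fun _ _ => mul_mem) (fun _ _ => add_mem) f

variable (G n)

lemma isClosed_rowAlgebra (k : ℕ) : IsClosed (G.rowAlgebra n k : Set (G.C n)) :=
  StarSubalgebra.isClosed_topologicalClosure _

variable {G n}

lemma u_mem_rowAlgebra {k : ℕ} {i : Fin n} (hi : k ≤ (i : ℕ)) (j : Fin n) :
    G.u n i j ∈ G.rowAlgebra n k :=
  StarSubalgebra.le_topologicalClosure _ (StarAlgebra.subset_adjoin ℂ _ ⟨i, j, hi, rfl⟩)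

end Generators

/-! ### The cases `k = 0`, `k = n`, and `k = 1` with column sums equal to `1` -/

section TrivialCases

variable (G : FreeSeries)

lemma rowAlgebra_zero (n : ℕ) : G.rowAlgebra n 0 = ⊤ :=
  eq_top_of_isClosed (G.isClosed_rowAlgebra n 0) fun _ j => u_mem_rowAlgebra (Nat.zero_le _) j

/-- The identity is `diag(v, 1)` with `v` the empty matrix, for which all the relations are vacuous;
this treats the four series at once. -/
lemma rel_one {B m : Type} [Ring B] [StarRing B] [Fintype m] [DecidableEq m] :
    G.Rel (1 : Matrix m m B) := by
  have h0 : G.Rel (0 : Matrix Empty Empty B) := by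
    have ho : IsOrthogonalMatrix (0 : Matrix Empty Empty B) :=
      .of_entries (fun i => i.elim) (fun i => i.elim) (fun i => i.elim)
    cases G
    · exact ho
    · exact ⟨ho, fun i => i.elim⟩
    · exact ⟨ho, fun i => i.elim, fun i => i.elim⟩
    · exact ⟨ho, fun i => i.elim, fun i => i.elim⟩
  have := (h0.fromBlocks (m' := m)).submatrix (Equiv.emptySum Empty m).symm
  convert this using 1
  ext i j
  rfl

/-- The counit `ε : C(Gₙ) → ℂ`, `u ↦ 1`. -/
def counit (n : ℕ) : G.C n →⋆ₐ[ℂ] ℂ := ofMatrix normedByReps_complex 1 G.rel_one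

lemma counit_u {n : ℕ} (i j : Fin n) : G.counit n (G.u n i j) = if i = j then 1 else 0 :=
  (ofMatrix_u _ _ _ i j).trans (Matrix.one_apply ..)

/-- For `k = n` the block `1ₙ₋ₖ` is empty: every index falls in the left summand of `splitIndex`. -/
lemma restrict_self (n : ℕ) : G.restrict (le_refl n) = StarAlgHom.id ℂ (G.C n) := by
  refine starAlgHom_ext fun i j => ?_
  have key : ∀ i : Fin n, splitIndex (le_refl n) i = Sum.inl i := fun i => by
    rw [← Equiv.eq_symm_apply]
    simp [splitIndex, Fin.ext_iff]
  rw [restrict_u, diagOne, Matrix.submatrix_apply, key, key]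
  rfl

/-- The counit law `(id ⊗ ε)Δ = id`. -/
lemma map_counit_comul (n : ℕ) (f : G.C n) :
    MinTensor.map (StarAlgHom.id ℂ (G.C n)) (G.counit n) (G.comul n f) = MinTensor.tmul f 1 := by
  have : (MinTensor.map (StarAlgHom.id ℂ (G.C n)) (G.counit n)).comp (G.comul n) =
      MinTensor.inclLeft (G.C n) ℂ := by
    refine starAlgHom_ext fun i j => ?_
    rw [StarAlgHom.comp_apply, comul_u, map_sum]
    simp only [MinTensor.map_tmul, counit_u]
    rw [Finset.sum_eq_single j]
    · rw [if_pos rfl]; rfl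
    · intro s _ hs
      rw [if_neg hs, MinTensor.tmul, TensorProduct.tmul_zero, map_zero]
    · simp
  exact DFunLike.congr_fun this f

/-- An element invariant under the whole quantum group is a scalar, by the counit law; `C_×`
contains the scalars because it is unital, although for `k = n` it has no generators. -/
lemma quotientAlgebra_self_le (n : ℕ) :
    G.quotientAlgebra (le_refl n) ≤ G.rowAlgebra n n := by
  intro f hf
  have h1 : G.coaction (le_refl n) f = MinTensor.tmul 1 f := hf
  have h2 : G.coaction (le_refl n) f = MinTensor.map (G.restrict (le_refl n))
      (StarAlgHom.id ℂ (G.C n)) (G.comul n f) := rfl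
  have hid : MinTensor.map (StarAlgHom.id ℂ (G.C n)) (StarAlgHom.id ℂ (G.C n)) =
      StarAlgHom.id ℂ (MinTensor (G.C n) (G.C n)) := by
    refine StarAlgHom.ext fun z => (minSeminorm (G.C n) (G.C n)).denseRange_ι.induction_on z
      (isClosed_eq (continuous_starAlgHom _) (continuous_starAlgHom _)) fun a => ?_
    induction a using TensorProduct.induction_on with
    | zero => simp
    | add x y hx hy => rw [map_add, map_add, hx, hy, map_add]
    | tmul a b => exact MinTensor.map_tmul _ _ a b
  rw [restrict_self, hid] at h2
  have h3 : G.comul n f = MinTensor.tmul 1 f := h2.symm.trans h1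
  have h4 := G.map_counit_comul n f
  rw [h3, MinTensor.map_tmul] at h4
  -- `f ⊗ 1 = 1 ⊗ ε(f)`, and the scalar `ε(f)` moves across the tensor sign.
  have h5 : MinTensor.tmul f (1 : ℂ) = MinTensor.tmul (algebraMap ℂ (G.C n) (G.counit n f)) 1 := by
    rw [Algebra.algebraMap_eq_smul_one, MinTensor.smul_tmul, smul_eq_mul, mul_one, ← h4, map_one]
  rw [MinTensor.tmul_one_injective (G.normedByReps_C n) h5]
  exact algebraMap_mem _ _

lemma rowAlgebra_one_eq_top {n : ℕ} (hsum : ∀ j, ∑ i, G.u n i j = 1) :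
    G.rowAlgebra n 1 = ⊤ := by
  refine eq_top_of_isClosed (G.isClosed_rowAlgebra n 1) fun i j => ?_
  by_cases hi : 1 ≤ (i : ℕ)
  · exact u_mem_rowAlgebra hi j
  · have hj := hsum j
    rw [← Finset.add_sum_erase _ _ (Finset.mem_univ i), ← eq_sub_iff_add_eq] at hj
    rw [hj]
    -- Here `i` is the row of index `0`, so every other row has index at least `1`.
    refine sub_mem (one_mem _) (sum_mem fun l hl => u_mem_rowAlgebra ?_ j)
    have := Finset.ne_of_mem_erase hl
    rw [Ne, Fin.ext_iff] at this
    omega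

end TrivialCases

end FreeSeries

/-! ### Magic matrices, and commutativity in size three -/

section Magic

variable {A m : Type} [CStarAlgebra A] [Fintype m] [DecidableEq m] {u : Matrix m m A}

namespace IsMagicMatrix

/-- For idempotent entries, the diagonal entries of `u uᵗ = 1` are the row sums. -/
lemma row_sum (h : IsMagicMatrix u) (i : m) : ∑ j, u i j = 1 := by
  have := h.row_mul i i
  simpa only [(h.projection _ _).isIdempotentElem.eq, if_true] using this

lemma col_sum (h : IsMagicMatrix u) (j : m) : ∑ i, u i j = 1 := by
  have := h.col_mul j j
  simpa only [(h.projection _ _).isIdempotentElem.eq, if_true] using this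

lemma row_mul_eq_zero (h : IsMagicMatrix u) (i : m) {j l : m} (hjl : j ≠ l) :
    u i j * u i l = 0 :=
  mul_eq_zero_of_sum_eq_one (u i) (h.projection i) (h.row_sum i) hjl

lemma col_mul_eq_zero (h : IsMagicMatrix u) (j : m) {i l : m} (hil : i ≠ l) :
    u i j * u l j = 0 :=
  mul_eq_zero_of_sum_eq_one (fun i => u i j) (fun i => h.projection i j) (h.col_sum j) hil

/-- The rows of a magic matrix may be permuted. -/
lemma permute_rows (h : IsMagicMatrix u) (σ : Equiv.Perm m) :
    IsMagicMatrix (u.submatrix σ id) := by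
  refine ⟨.of_entries (fun i j => h.selfAdjoint _ _) (fun i j => ?_) (fun i j => ?_),
    fun i j => h.projection _ _⟩
  · simp only [← σ.injective.eq_iff (a := i)]
    exact h.row_mul _ _
  · rw [← h.col_mul i j, ← Equiv.sum_comp σ (fun l => u l i * u l j)]
    rfl

end IsMagicMatrix

/-- For entries in different rows and columns, a third column `m` completes `j, l`. Inserting a row
sum and cancelling by orthogonality shows `u i j * u k l = u i j * u k l * u i j`, whose right side
is self-adjoint; a product of two projections that is self-adjoint is a commuting product. -/
lemma IsMagicMatrix.commute_three {u : Matrix (Fin 3) (Fin 3) A} (h : IsMagicMatrix u)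
    (i j k l : Fin 3) : Commute (u i j) (u k l) := by
  rcases eq_or_ne i k with rfl | hik
  · rcases eq_or_ne j l with rfl | hjl
    · exact Commute.refl _
    · rw [commute_iff_eq, h.row_mul_eq_zero i hjl, h.row_mul_eq_zero i hjl.symm]
  rcases eq_or_ne j l with rfl | hjl
  · rw [commute_iff_eq, h.col_mul_eq_zero j hik, h.col_mul_eq_zero j hik.symm]
  obtain ⟨m, hmj, hml, huniv⟩ : ∃ m : Fin 3, m ≠ j ∧ m ≠ l ∧
      (Finset.univ : Finset (Fin 3)) = {j, l, m} := by
    revert j l; decide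
  have sum3 : ∀ f : Fin 3 → A, ∑ c, f c = f j + (f l + f m) := fun f => by
    rw [huniv, Finset.sum_insert (by simp [hjl, hmj.symm]), Finset.sum_insert (by simp [hml.symm]),
      Finset.sum_singleton]
  -- Insert `∑ c, u k c = 1` into `u i j * u i m = 0`: the term `c = j` dies on the left and `c = m`
  -- on the right, by column orthogonality, leaving only `c = l`.
  have h0 : u i j * u k l * u i m = 0 := by
    have e : u i j * (∑ c, u k c) * u i m = 0 := by
      rw [h.row_sum, mul_one, h.row_mul_eq_zero i hmj.symm]
    rwa [sum3, mul_add, mul_add, h.col_mul_eq_zero j hik, zero_add, add_mul, mul_assoc _ (u k m),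
      h.col_mul_eq_zero m hik.symm, mul_zero, add_zero] at e
  -- Multiply on the right by `∑ c, u i c = 1`: column orthogonality kills `c = l`, and `h0` kills
  -- `c = m`.
  have h1 : u i j * u k l = u i j * u k l * u i j := by
    have e : u i j * u k l * (∑ c, u i c) = u i j * u k l := by rw [h.row_sum, mul_one]
    rw [sum3, mul_add, mul_add, h0, mul_assoc _ _ (u i l), h.col_mul_eq_zero l hik.symm, mul_zero,
      add_zero, add_zero] at e
    exact e.symm
  have h2 := congrArg star h1
  rw [star_mul, star_mul, star_mul, (h.selfAdjoint i j).star_eq, (h.selfAdjoint k l).star_eq,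
    ← mul_assoc, ← h1] at h2
  exact h2.symm

end Magic

/-- Here `(x, y, z)` and `(p, q, r)` stand for the first and last rows of a permutation matrix, and
`w = xr + yp + zq` for the indicator of the even permutations. Given the image of the last point,
the first has two possible images, and parity chooses: for instance `x = r w + q (1 - w)`. -/
lemma even_decomposition {R : Type} [CommRing R] {x y z p q r : R} (hx : x + y + z = 1)
    (hp : p + q + r = 1) (hxp : x * p = 0) (hyq : y * q = 0) (hzr : z * r = 0)
    (hxx : x * x = x) (hzz : z * z = z) (hpp : p * p = p)
    (hrr : r * r = r) (hpq : p * q = 0) :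
    (x * r + y * p + z * q) * (x * r + y * p + z * q) = x * r + y * p + z * q ∧
      x = q + (r - q) * (x * r + y * p + z * q) ∧
      y = r + (p - r) * (x * r + y * p + z * q) ∧
      z = p + (q - p) * (x * r + y * p + z * q) := by
  refine ⟨?_, ?_, ?_, ?_⟩ <;> grind

namespace FreeSeries

/-! ### The case `S₃⁺/S₂⁺` -/

section SymmetricThree

lemma magic_u (n : ℕ) : IsMagicMatrix (S.u n) := S.rel_u n

/-- The character of `C(S₂⁺)` given by the transposition. -/
def swapCharacter : S.C 2 →⋆ₐ[ℂ] ℂ :=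
  ofMatrix normedByReps_complex ((1 : Matrix (Fin 2) (Fin 2) ℂ).submatrix (Equiv.swap 0 1) id)
    (IsMagicMatrix.permute_rows (rel_one S) _)

/-- The automorphism of `C(S₃⁺)` that exchanges the first two rows of generators. -/
def swapRows : S.C 3 →⋆ₐ[ℂ] S.C 3 :=
  ofMatrix (S.normedByReps_C 3) ((S.u 3).submatrix (Equiv.swap 0 1) id)
    ((magic_u 3).permute_rows _)

lemma swapRows_u (i j : Fin 3) : swapRows (S.u 3 i j) = S.u 3 (Equiv.swap 0 1 i) j :=
  ofMatrix_u _ _ _ i j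

/-- The transposition of `S₂`, seen in `S₃`, exchanges the first two points and fixes the last. The
four cases are the blocks of `diag(v, 1)`. -/
lemma swapCharacter_restrict_u (h : 2 ≤ 3) (i j : Fin 3) :
    swapCharacter (S.restrict h (S.u 3 i j)) = if Equiv.swap 0 1 i = j then 1 else 0 := by
  have hu : ∀ i j : Fin 2, swapCharacter (S.u 2 i j) = if Equiv.swap 0 1 i = j then 1 else 0 :=
    fun i j => (ofMatrix_u _ _ _ i j).trans (Matrix.one_apply ..)
  have hs : ∀ i : Fin 2, (splitIndex h).symm (Sum.inl i) = i.castSucc :=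
    fun _ => rfl
  have ht : ∀ i : Fin 1, (splitIndex h).symm (Sum.inr i) = 2 := by
    intro i
    rw [Subsingleton.elim i 0]
    rfl
  rw [restrict_u]
  obtain ⟨i, rfl⟩ := (splitIndex h).symm.surjective i
  obtain ⟨j, rfl⟩ := (splitIndex h).symm.surjective j
  simp only [diagOne, Matrix.submatrix_apply, Equiv.apply_symm_apply]
  rcases i with i | i <;> rcases j with j | j
  · rw [Matrix.fromBlocks_apply₁₁, hu, hs, hs]
    congr 1
    revert i j
    decide
  · rw [Matrix.fromBlocks_apply₁₂, hs, ht, Matrix.zero_apply, map_zero, if_neg]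
    revert i
    decide
  · rw [Matrix.fromBlocks_apply₂₁, hs, ht, Matrix.zero_apply, map_zero, if_neg]
    revert j
    decide
  · rw [Matrix.fromBlocks_apply₂₂, ht, ht, Subsingleton.elim (α := Fin 1) i j, Matrix.one_apply_eq,
      map_one, if_pos (by decide)]

/-- The elements of `C(S₃⁺/S₂⁺)` are invariant under the exchange of the first two rows. -/
lemma swapRows_eq_self (h : 2 ≤ 3) {f : S.C 3} (hf : f ∈ S.quotientAlgebra h) :
    swapRows f = f := by
  have hf' : S.coaction h f = MinTensor.tmul 1 f := hf
  -- Evaluating the first leg of the coaction at the transposition translates by it, which exchanges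
  -- the rows; on invariant elements the same evaluation gives `1 ⊗ f`.
  have key : (MinTensor.map swapCharacter (StarAlgHom.id ℂ (S.C 3))).comp (S.coaction h) =
      (MinTensor.inclRight ℂ (S.C 3)).comp swapRows := by
    refine starAlgHom_ext fun i j => ?_
    have e : S.coaction h (S.u 3 i j) =
        MinTensor.map (S.restrict h) (StarAlgHom.id ℂ (S.C 3)) (S.comul 3 (S.u 3 i j)) := rfl
    rw [StarAlgHom.comp_apply, StarAlgHom.comp_apply, e, comul_u, map_sum, map_sum, swapRows_u]
    simp only [MinTensor.map_tmul, swapCharacter_restrict_u]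
    rw [Finset.sum_eq_single (Equiv.swap 0 1 i)]
    · rw [if_pos rfl]; rfl
    · intro s _ hs
      rw [if_neg hs.symm, MinTensor.tmul, TensorProduct.zero_tmul, map_zero]
    · simp
  have := DFunLike.congr_fun key f
  rw [StarAlgHom.comp_apply, StarAlgHom.comp_apply, hf', MinTensor.map_tmul, map_one] at this
  exact MinTensor.one_tmul_injective (S.normedByReps_C 3) this.symm

/-- The sum of the indicator functions of the even permutations in `C(S₃⁺)`. -/
def evenPart : S.C 3 :=
  S.u 3 0 0 * S.u 3 2 2 + S.u 3 0 1 * S.u 3 2 0 + S.u 3 0 2 * S.u 3 2 1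

/-- `S₃⁺ = S₃`: the generators commute by `commute_three`, and commutation passes to polynomials and
limits, in each argument in turn. -/
lemma commute_C_three (f g : S.C 3) : Commute f g := by
  refine C_induction (P := fun f => ∀ g, Commute f g) ?_ (fun i j g => ?_) (fun c g => ?_)
    (fun a b ha hb g => (ha g).mul_left (hb g)) (fun a b ha hb g => (ha g).add_left (hb g)) f g
  · simp only [commute_iff_eq, Set.ofPred_forall]
    exact isClosed_iInter fun g => isClosed_eq (by fun_prop) (by fun_prop)
  · refine C_induction (P := fun g => Commute (S.u 3 i j) g) ?_
      (fun k l => (magic_u 3).commute_three i j k l) (fun c => ?_)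
      (fun a b ha hb => ha.mul_right hb) (fun a b ha hb => ha.add_right hb) g
    · exact isClosed_eq (by fun_prop) (by fun_prop)
    · exact (Algebra.commutes c _).symm
  · exact Algebra.commutes c g

lemma u_row_sum_three (i : Fin 3) : S.u 3 i 0 + S.u 3 i 1 + S.u 3 i 2 = 1 := by
  rw [← Fin.sum_univ_three]; exact (magic_u 3).row_sum i

lemma u_col_sum_three (j : Fin 3) : S.u 3 0 j + S.u 3 1 j + S.u 3 2 j = 1 := by
  rw [← Fin.sum_univ_three (fun i => S.u 3 i j)]; exact (magic_u 3).col_sum j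

/-- A transposition exchanges even and odd permutations. Concretely, the terms pair up as `(u 0 j +
u 1 j) * u 2 i = (1 - u 2 j) * u 2 i = u 2 i` with `i ≠ j`, and the last row sums to `1`. -/
lemma evenPart_add_swapRows : evenPart + swapRows evenPart = 1 := by
  have h0 : Equiv.swap (0 : Fin 3) 1 0 = 1 := by decide
  have h2 : Equiv.swap (0 : Fin 3) 1 2 = 2 := by decide
  have hm : ∀ i j : Fin 3, i ≠ j → S.u 3 2 i * S.u 3 2 j = 0 := fun i j hij =>
    (magic_u 3).row_mul_eq_zero 2 hij
  have hp : ∀ j, S.u 3 2 j * S.u 3 2 j = S.u 3 2 j := fun j =>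
    ((magic_u 3).projection 2 j).isIdempotentElem.eq
  have hc : ∀ j, S.u 3 1 j = 1 - S.u 3 2 j - S.u 3 0 j := fun j => by
    rw [← u_col_sum_three j]; abel
  have hq : ∀ i j, S.u 3 1 j * S.u 3 2 i + S.u 3 0 j * S.u 3 2 i =
      S.u 3 2 i - S.u 3 2 j * S.u 3 2 i := fun i j => by
    rw [hc]; noncomm_ring
  have e0 := hq 2 0
  have e1 := hq 0 1
  have e2 := hq 1 2
  rw [hm _ _ (by decide), sub_zero] at e0 e1 e2
  simp only [evenPart, map_add, map_mul, swapRows_u, h0, h2]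
  calc _ = (S.u 3 1 0 * S.u 3 2 2 + S.u 3 0 0 * S.u 3 2 2) +
        (S.u 3 1 1 * S.u 3 2 0 + S.u 3 0 1 * S.u 3 2 0) +
        (S.u 3 1 2 * S.u 3 2 1 + S.u 3 0 2 * S.u 3 2 1) := by abel
    _ = S.u 3 2 0 + S.u 3 2 1 + S.u 3 2 2 := by rw [e0, e1, e2]; abel
    _ = 1 := u_row_sum_three 2

lemma u_three_decomposition :
    evenPart * evenPart = evenPart ∧
      S.u 3 0 0 = S.u 3 2 1 + (S.u 3 2 2 - S.u 3 2 1) * evenPart ∧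
      S.u 3 0 1 = S.u 3 2 2 + (S.u 3 2 0 - S.u 3 2 2) * evenPart ∧
      S.u 3 0 2 = S.u 3 2 0 + (S.u 3 2 1 - S.u 3 2 0) * evenPart := by
  -- Built on the existing ring structure, so that `even_decomposition` speaks of the same
  -- operations.
  let _ : CommRing (S.C 3) :=
    { (inferInstance : Ring (S.C 3)) with mul_comm := commute_C_three }
  have hz : ∀ j, S.u 3 0 j * S.u 3 2 j = 0 := fun j =>
    (magic_u 3).col_mul_eq_zero j (show (0 : Fin 3) ≠ 2 by decide)
  have hp : ∀ i j, S.u 3 i j * S.u 3 i j = S.u 3 i j := fun i j =>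
    ((magic_u 3).projection i j).isIdempotentElem.eq
  exact even_decomposition (u_row_sum_three 0) (u_row_sum_three 2) (hz 0) (hz 1) (hz 2)
    (hp 0 0) (hp 0 2) (hp 2 0) (hp 2 2)
    ((magic_u 3).row_mul_eq_zero 2 (show (0 : Fin 3) ≠ 1 by decide))

/-- A polynomial in the generators of `C(S₃⁺)` is `a + b w`, where `a` and `b` lie in the algebra
of the last row of generators, and `w` is `evenPart`. -/
lemma exists_eq_add_mul_evenPart (x : FreeSA (Fin 3 × Fin 3)) :
    ∃ a ∈ S.rowAlgebra 3 2, ∃ b ∈ S.rowAlgebra 3 2,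
      (S.univSeminorm 3).ι x = a + b * evenPart := by
  have hR : ∀ j, S.u 3 2 j ∈ S.rowAlgebra 3 2 := fun j =>
    u_mem_rowAlgebra (i := 2) (show 2 ≤ ((2 : Fin 3) : ℕ) by decide) j
  obtain ⟨hw, h0, h1, h2⟩ := u_three_decomposition
  have hrow0 : ∀ j, ∃ a ∈ S.rowAlgebra 3 2, ∃ b ∈ S.rowAlgebra 3 2,
      S.u 3 0 j = a + b * evenPart := by
    intro j
    fin_cases j
    · exact ⟨_, hR 1, _, sub_mem (hR 2) (hR 1), h0⟩
    · exact ⟨_, hR 2, _, sub_mem (hR 0) (hR 2), h1⟩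
    · exact ⟨_, hR 0, _, sub_mem (hR 1) (hR 0), h2⟩
  have hgen : ∀ i j, ∃ a ∈ S.rowAlgebra 3 2, ∃ b ∈ S.rowAlgebra 3 2,
      S.u 3 i j = a + b * evenPart := by
    intro i j
    fin_cases i
    · exact hrow0 j
    · obtain ⟨a, ha, b, hb, e⟩ := hrow0 j
      -- The middle row is `1` minus the other two, by the column sums.
      refine ⟨1 - S.u 3 2 j - a, sub_mem (sub_mem (one_mem _) (hR j)) ha, -b, neg_mem hb, ?_⟩
      change S.u 3 1 j = _
      rw [← u_col_sum_three j, e]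
      noncomm_ring
    · exact ⟨S.u 3 2 j, hR j, 0, zero_mem _, by rw [zero_mul, add_zero]; rfl⟩
  refine FreeSA.induction (P := fun x => ∃ a ∈ S.rowAlgebra 3 2, ∃ b ∈ S.rowAlgebra 3 2,
    (S.univSeminorm 3).ι x = a + b * evenPart) (fun x => hgen x.1 x.2) (fun c => ?_) ?_ ?_ x
  · exact ⟨_, algebraMap_mem _ c, 0, zero_mem _, by rw [AlgHomClass.commutes, zero_mul, add_zero]⟩
  · rintro x y ⟨a, ha, b, hb, e⟩ ⟨c, hc, d, hd, e'⟩
    -- `(a + bw)(c + dw) = ac + (ad + bc + bd)w`, since `w` commutes with everything and `w² = w`.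
    refine ⟨a * c, mul_mem ha hc, a * d + b * c + b * d,
      add_mem (add_mem (mul_mem ha hd) (mul_mem hb hc)) (mul_mem hb hd), ?_⟩
    have hwc : evenPart * c = c * evenPart := commute_C_three _ _
    have hwd : evenPart * (d * evenPart) = d * evenPart := by
      rw [← mul_assoc, commute_C_three evenPart d, mul_assoc, hw]
    rw [map_mul, e, e', mul_add, add_mul, add_mul, mul_assoc b evenPart c, hwc,
      mul_assoc b evenPart, hwd]
    noncomm_ring
  · rintro x y ⟨a, ha, b, hb, e⟩ ⟨c, hc, d, hd, e'⟩
    refine ⟨a + c, add_mem ha hc, b + d, add_mem hb hd, ?_⟩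
    rw [map_add, e, e', add_mul]
    abel

/-- Averaging over the exchange of the first two rows maps `C(S₃⁺)` into the algebra of the last
row, and does nothing to invariant elements. -/
lemma quotientAlgebra_three_two_le (h : 2 ≤ 3) :
    S.quotientAlgebra h ≤ S.rowAlgebra 3 2 := by
  have hfix : ∀ a ∈ S.rowAlgebra 3 2, swapRows a = a := by
    refine fun a ha => StarSubalgebra.topologicalClosure_minimal
      (t := StarAlgHom.equalizer swapRows (StarAlgHom.id ℂ (S.C 3))) (StarAlgebra.adjoin_le ?_)
      (isClosed_eq (continuous_starAlgHom _) continuous_id) ha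
    rintro _ ⟨i, j, hi, rfl⟩
    obtain rfl : i = 2 := by omega
    exact swapRows_u 2 j
  -- Membership of `f + σ(f)` in the closed algebra is a closed condition on `f`, so polynomials
  -- suffice, and closedness of `R + Rw` is not needed.
  have havg : ∀ f, f + swapRows f ∈ S.rowAlgebra 3 2 := fun f => by
    refine (S.univSeminorm 3).denseRange_ι.induction_on f
      ((S.isClosed_rowAlgebra 3 2).preimage
        (continuous_id.add (continuous_starAlgHom swapRows))) fun x => ?_
    obtain ⟨a, ha, b, hb, e⟩ := exists_eq_add_mul_evenPart x
    have : (S.univSeminorm 3).ι x + swapRows ((S.univSeminorm 3).ι x) = a + a + b := by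
      rw [e, map_add, map_mul, hfix a ha, hfix b hb,
        show a + b * evenPart + (a + b * swapRows evenPart) =
          a + a + b * (evenPart + swapRows evenPart) by noncomm_ring,
        evenPart_add_swapRows, mul_one]
    change _ + _ ∈ _
    rw [this]
    exact add_mem (add_mem ha ha) hb
  intro f hf
  have h2 := havg f
  rw [swapRows_eq_self h hf, ← two_smul ℂ] at h2
  simpa using (S.rowAlgebra 3 2).smul_mem h2 (2⁻¹ : ℂ)

end SymmetricThree

end FreeSeries

end

/-! ### Assembly of the cases -/

theorem proposition4p2 (G : FreeSeries) (n k : ℕ) (hk : k ≤ n)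
    (hcase : n = 1 ∨ k = 0 ∨ k = n ∨ (G = FreeSeries.B ∧ k = 1) ∨
      (G = FreeSeries.S ∧ (k = 1 ∨ (k = 2 ∧ n = 3)))) :
    Function.Bijective
      (StarSubalgebra.inclusion (G.rowAlgebra_le_quotientAlgebra hk) :
        G.rowAlgebra n k →⋆ₐ[ℂ] G.quotientAlgebra hk) := by
  have hle : G.quotientAlgebra hk ≤ G.rowAlgebra n k := by
    have h0 : k = 0 → G.quotientAlgebra hk ≤ G.rowAlgebra n k := by
      rintro rfl
      rw [FreeSeries.rowAlgebra_zero]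
      exact le_top
    have hn : k = n → G.quotientAlgebra hk ≤ G.rowAlgebra n k := by
      rintro rfl
      exact G.quotientAlgebra_self_le k
    rcases hcase with rfl | h | h | ⟨rfl, rfl⟩ | ⟨rfl, rfl | ⟨rfl, rfl⟩⟩
    · rcases Nat.le_one_iff_eq_zero_or_eq_one.1 hk with h | h
      · exact h0 h
      · exact hn h
    · exact h0 h
    · exact hn h
    · rw [FreeSeries.rowAlgebra_one_eq_top _ (IsBistochasticMatrix.col_sum (FreeSeries.B.rel_u n))]
      exact le_top
    · rw [FreeSeries.rowAlgebra_one_eq_top _ (FreeSeries.magic_u n).col_sum]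
      exact le_top
    · exact FreeSeries.quotientAlgebra_three_two_le hk
  -- Surjectivity of the inclusion is exactly `hle`; injectivity holds because both sides sit inside
  -- `C(Gₙ)`.
  refine ⟨fun x y h => ?_, fun x => ⟨⟨x, hle x.2⟩, rfl⟩⟩
  exact Subtype.ext (congrArg (fun z : G.quotientAlgebra hk => (z : G.C n)) h)
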